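/- Let $k$ be a field, $Q=k[X]$ a polynomial ring in finitely many variables $X$, and $H\subseteq J$ two prime ideals of $Q$. Let $A=Q/H$, let $L=J\cdot A$ be the prime ideal of $A$ induced by $J$, let $A_L$ be the localization of $A$ at $L$, $\mathfrak a$ its maximal ideal, $K=A_L/\mathfrak a$ its residue field, and $$\mathrm{Gr}_{\mathfrak a}(A_L)=\bigoplus_{n\ge 0}\mathfrak a^n/\mathfrak a^{n+1},$$ the associated graded ring, regarded as an algebra over its degree-zero part $K$. Let $U\subseteq X$ be a set of variables that is maximal (under inclusion) with $J\cap k[U]=0$, let $V=X\setminus U$, and put $Q^0=k(U)[V]$, $H^0=H\cdot Q^0$, $J^0=J\cdot Q^0$; then $J^0$ is a maximal ideal and $Q^0/J^0\cong K$ canonically. Let $f_1,\dots,f_s$ generate the ideal $J$, let $Y=(Y_1,\dots,Y_s)$ be new variables, and let $$\mathfrak I=\langle f_1-Y_1,\dots,f_s-Y_s\rangle+H^0\cdot Q^0[Y]\ \trianglelefteq\ Q^0[Y].$$ For $g\in Q^0[Y]$ let $g_{\mathrm{in}}\in (Q^0/J^0)[Y]=K[Y]$ be obtained from $g$ by taking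 the sum of the terms of lowest total degree in $Y$ and reducing its coefficients modulo $J^0$, and let $\mathfrak I_{\mathrm{in}}=\langle g_{\mathrm{in}}\mid g\in\mathfrak I\rangle\trianglelefteq K[Y]$. Then the following are equivalent: 1. $A_L$ is a regular local ring, i.e. $\dim_K(\mathfrak a/\mathfrak a^2)=\dim A_L$; 2. $\mathrm{Gr}_{\mathfrak a}(A_L)$ is isomorphic, as a $K$-algebra, to a polynomial ring $K[Z_1,\dots,Z_d]$ for some $d\ge 0$; 3. the ideal $\mathfrak I_{\mathrm{in}}$ is generated by linear elements, i.e. by linear forms (homogeneous polynomials of degree $1$, or $0$) in $Y_1,\dots,Y_s$. -/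

import Mathlib

noncomputable section

/-! ### The associated graded ring of an ideal -/

section AssociatedGraded

variable {R : Type*} [CommRing R] (I : Ideal R)

/-- The graded piece `I ^ n / I ^ (n + 1)`. -/
abbrev GradedPiece (n : ℕ) : Type _ :=
  ↥(I ^ n) ⧸ Submodule.submoduleOf (I ^ (n + 1)) (I ^ n)

namespace GradedPiece

/-- The residue class in `I ^ n / I ^ (n + 1)` of an element of `I ^ n`. -/
abbrev mk (n : ℕ) (x : R) (hx : x ∈ I ^ n) : GradedPiece I n :=
  Submodule.Quotient.mk ⟨x, hx⟩

variable {I}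

theorem mk_eq_zero {n : ℕ} {x : R} (hx : x ∈ I ^ n) (h : x ∈ I ^ (n + 1)) : mk I n x hx = 0 :=
  (Submodule.Quotient.mk_eq_zero _).2 h

theorem gmk_congr {m n : ℕ} {x y : R} {hx : x ∈ I ^ m} {hy : y ∈ I ^ n} (hmn : m = n)
    (hxy : x = y) :
    (GradedMonoid.mk m (mk I m x hx) : GradedMonoid (GradedPiece I)) =
      GradedMonoid.mk n (mk I n y hy) := by
  subst hmn hxy
  rfl

theorem mul_mem {m n : ℕ} (x : ↥(I ^ m)) (y : ↥(I ^ n)) : (x : R) * y ∈ I ^ (m + n) := by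
  rw [pow_add]
  exact Ideal.mul_mem_mul x.2 y.2

variable (I) in
/-- `(x, y) ↦ class of x * y`, on representatives. -/
def preMul (m n : ℕ) : ↥(I ^ m) →ₗ[R] ↥(I ^ n) →ₗ[R] GradedPiece I (m + n) :=
  LinearMap.mk₂ R (fun x y => mk I (m + n) (x * y) (mul_mem x y))
    (fun x y z => by
      rw [← Submodule.Quotient.mk_add]; congr 1; simp [add_mul])
    (fun r x y => by
      rw [← Submodule.Quotient.mk_smul]; congr 1; simp [mul_assoc])
    (fun x y z => by
      rw [← Submodule.Quotient.mk_add]; congr 1; simp [mul_add])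
    (fun r x y => by
      rw [← Submodule.Quotient.mk_smul]; congr 1; simp [mul_left_comm])

variable (I) in
/-- The multiplication `I ^ m / I ^ (m + 1) × I ^ n / I ^ (n + 1) → I ^ (m + n) / I ^ (m + n + 1)`,
`(class of x, class of y) ↦ class of x * y`. -/
def mulMap (m n : ℕ) : GradedPiece I m →ₗ[R] GradedPiece I n →ₗ[R] GradedPiece I (m + n) :=
  (Submodule.liftQ _
    (Submodule.liftQ _ (preMul I m n) (fun x hx => by
      rw [LinearMap.mem_ker]
      refine LinearMap.ext fun y => mk_eq_zero _ ?_
      have h : (x : R) * y ∈ I ^ (m + 1) * I ^ n := Ideal.mul_mem_mul hx y.2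
      rwa [← pow_add, add_right_comm] at h)).flip
    (fun y hy => by
      rw [LinearMap.mem_ker]
      refine LinearMap.ext fun x => ?_
      induction x using Submodule.Quotient.induction_on with | _ x
      refine mk_eq_zero _ ?_
      have h : (x : R) * y ∈ I ^ m * I ^ (n + 1) := Ideal.mul_mem_mul x.2 hy
      rwa [← pow_add, ← add_assoc] at h)).flip

instance : GradedMonoid.GMul (GradedPiece I) where
  mul {m n} a b := mulMap I m n a b

instance : GradedMonoid.GOne (GradedPiece I) where
  one := mk I 0 1 (by simp)

theorem gmk_mul {m n : ℕ} {x y : R} (hx : x ∈ I ^ m) (hy : y ∈ I ^ n) :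
    (GradedMonoid.mk m (mk I m x hx) * GradedMonoid.mk n (mk I n y hy) :
        GradedMonoid (GradedPiece I)) =
      GradedMonoid.mk (m + n) (mk I (m + n) (x * y) (mul_mem ⟨x, hx⟩ ⟨y, hy⟩)) := rfl

theorem gmk_one :
    (1 : GradedMonoid (GradedPiece I)) = GradedMonoid.mk 0 (mk I 0 1 (by simp)) := rfl

theorem gmk_cases {p : GradedMonoid (GradedPiece I) → Prop}
    (h : ∀ n x hx, p (GradedMonoid.mk n (mk I n x hx))) (a : GradedMonoid (GradedPiece I)) :
    p a := by
  obtain ⟨n, a⟩ := a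
  induction a using Submodule.Quotient.induction_on with | _ x
  exact h n x.1 x.2

instance : DirectSum.GCommRing (GradedPiece I) where
  mul_zero a := map_zero (mulMap I _ _ a)
  zero_mul b := LinearMap.map_zero₂ (mulMap I _ _) b
  mul_add a b c := map_add (mulMap I _ _ a) b c
  add_mul a b c := LinearMap.map_add₂ (mulMap I _ _) a b c
  one_mul a := by
    induction a using gmk_cases with | _ n x hx
    rw [gmk_one, gmk_mul]
    exact gmk_congr (zero_add _) (one_mul _)
  mul_one a := by
    induction a using gmk_cases with | _ n x hx
    rw [gmk_one, gmk_mul]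
    exact gmk_congr (add_zero _) (mul_one _)
  mul_assoc a b c := by
    induction a using gmk_cases with | _ m x hx
    induction b using gmk_cases with | _ n y hy
    induction c using gmk_cases with | _ l z hz
    simp only [gmk_mul]
    exact gmk_congr (add_assoc _ _ _) (mul_assoc _ _ _)
  mul_comm a b := by
    induction a using gmk_cases with | _ m x hx
    induction b using gmk_cases with | _ n y hy
    simp only [gmk_mul]
    exact gmk_congr (add_comm _ _) (mul_comm _ _)
  natCast n := mk I 0 n (by simp)
  natCast_zero := mk_eq_zero _ (by simp)
  natCast_succ n := by
    change _ = Submodule.Quotient.mk _ + Submodule.Quotient.mk _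
    rw [← Submodule.Quotient.mk_add]; congr 1; simp
  intCast n := mk I 0 n (by simp)
  intCast_ofNat n := by congr 2; simp
  intCast_negSucc_ofNat n := by
    rw [← Submodule.Quotient.mk_neg]; congr 1; simp

end GradedPiece

/-- The associated graded ring `⨁ n, I ^ n / I ^ (n + 1)` of `R` with respect to `I`. -/
def AssociatedGraded : Type _ := DirectSum ℕ (GradedPiece I)

namespace AssociatedGraded

instance : CommRing (AssociatedGraded I) := DirectSum.commRing (GradedPiece I)

/-- The inclusion of the graded piece `I ^ n / I ^ (n + 1)`. -/
def of (n : ℕ) : GradedPiece I n →+ AssociatedGraded I := DirectSum.of (GradedPiece I) n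

theorem of_mul_of {m n : ℕ} {x y : R} (hx : x ∈ I ^ m) (hy : y ∈ I ^ n) :
    of I m (GradedPiece.mk I m x hx) * of I n (GradedPiece.mk I n y hy) =
      of I (m + n) (GradedPiece.mk I (m + n) (x * y)
        (GradedPiece.mul_mem ⟨x, hx⟩ ⟨y, hy⟩)) :=
  DirectSum.of_mul_of (A := GradedPiece I) _ _

theorem of_one : of I 0 (GradedPiece.mk I 0 1 (by simp)) = 1 := rfl

/-- The ring homomorphism from `R` that sends `r` to its class in `I ^ 0 / I ^ 1`. -/
def ofRing : R →+* AssociatedGraded I where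
  toFun r := of I 0 (GradedPiece.mk I 0 r (by simp))
  map_one' := rfl
  map_zero' := (congrArg (of I 0) (GradedPiece.mk_eq_zero _ (by simp))).trans (map_zero _)
  map_add' r s := map_add (of I 0) (GradedPiece.mk I 0 r (by simp)) (GradedPiece.mk I 0 s (by simp))
  map_mul' r s := (of_mul_of I (m := 0) (n := 0) (by simp) (by simp)).symm

/-- `AssociatedGraded I` is an algebra over `R / I`, which is its degree-zero part. -/
instance : Algebra (R ⧸ I) (AssociatedGraded I) :=
  (Ideal.Quotient.lift I (ofRing I) (fun r hr =>
    (congrArg (of I 0) (GradedPiece.mk_eq_zero (by simp) (by simpa using hr))).trans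
      (map_zero _))).toAlgebra

end AssociatedGraded

end AssociatedGraded

/-! ### The localization of an affine coordinate ring at a prime ideal -/

section Localization

variable {Q : Type*} [CommRing Q]

/-- The ideal `L = J · A` of `A = Q / H`. -/
abbrev idealL (H J : Ideal Q) : Ideal (Q ⧸ H) := J.map (Ideal.Quotient.mk H)

theorem idealL_isPrime {H J : Ideal Q} [J.IsPrime] (hHJ : H ≤ J) : (idealL H J).IsPrime :=
  Ideal.map_isPrime_of_surjective Ideal.Quotient.mk_surjective (by simpa using hHJ)

/-- The localization `A_L` of `A = Q / H` at the prime ideal `L = J · A`. -/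
def LocalizationAL {H J : Ideal Q} [J.IsPrime] (hHJ : H ≤ J) : Type _ :=
  haveI := idealL_isPrime hHJ
  Localization.AtPrime (idealL H J)

section Instances

variable {H J : Ideal Q} [J.IsPrime] (hHJ : H ≤ J)

instance : CommRing (LocalizationAL hHJ) :=
  haveI := idealL_isPrime hHJ
  inferInstanceAs (CommRing (Localization.AtPrime (idealL H J)))

instance : Algebra (Q ⧸ H) (LocalizationAL hHJ) :=
  haveI := idealL_isPrime hHJ
  inferInstanceAs (Algebra (Q ⧸ H) (Localization.AtPrime (idealL H J)))

instance :
    haveI := idealL_isPrime hHJ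
    IsLocalization.AtPrime (LocalizationAL hHJ) (idealL H J) :=
  haveI := idealL_isPrime hHJ
  inferInstanceAs (IsLocalization.AtPrime (Localization.AtPrime (idealL H J)) (idealL H J))

instance : IsLocalRing (LocalizationAL hHJ) :=
  haveI := idealL_isPrime hHJ
  IsLocalization.AtPrime.isLocalRing (LocalizationAL hHJ) (idealL H J)

end Instances

/-- The maximal ideal `𝔞` of `A_L`. -/
abbrev idealAL {H J : Ideal Q} [J.IsPrime] (hHJ : H ≤ J) : Ideal (LocalizationAL hHJ) :=
  IsLocalRing.maximalIdeal (LocalizationAL hHJ)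

end Localization

/-! ### The rings `Q⁰`, `Q⁰[Y]`, `K[Y]` and the ideals `𝔍`, `𝔍_in` -/

section InitialIdeal

open MvPolynomial

variable {k : Type*} [Field k] {σ : Type*}

/-- A set `U` of variables is independent with respect to `J` if `J ∩ k[U] = 0`. -/
def IsIndependentSet (J : Ideal (MvPolynomial σ k)) (U : Set σ) : Prop :=
  ∀ p ∈ J, p ∈ Set.range (rename ((↑) : U → σ) : MvPolynomial U k → MvPolynomial σ k) → p = 0

/-- A set of variables which is maximal among those independent with respect to `J`. -/
def IsMaximalIndependentSet (J : Ideal (MvPolynomial σ k)) (U : Set σ) : Prop :=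
  Maximal (IsIndependentSet J) U

/-- The ring `Q⁰ = k(U)[V]`, where `V` is the complement of `U` in the set of variables. -/
abbrev Q0 (k : Type*) [Field k] {σ : Type*} (U : Set σ) : Type _ :=
  MvPolynomial ↥(Uᶜ) (FractionRing (MvPolynomial ↥U k))

open Classical in
/-- The canonical embedding `Q = k[X] → Q⁰ = k(U)[V]`. -/
def toQ0 (k : Type*) [Field k] {σ : Type*} (U : Set σ) : MvPolynomial σ k →+* Q0 k U :=
  eval₂Hom (C.comp ((algebraMap (MvPolynomial ↥U k) (FractionRing (MvPolynomial ↥U k))).comp C))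
    (fun x => if hx : x ∈ U then C (algebraMap (MvPolynomial ↥U k) _ (X ⟨x, hx⟩)) else X ⟨x, hx⟩)

/-- The extension `J⁰ = J · Q⁰` of an ideal `J` of `Q`. -/
abbrev ideal0 (J : Ideal (MvPolynomial σ k)) (U : Set σ) : Ideal (Q0 k U) := J.map (toQ0 k U)

variable {s : ℕ}

/-- The ideal `𝔍 = ⟨f₁ - Y₁, …, f_s - Y_s⟩ + H⁰` of `Q⁰[Y]`. -/
def idealFrakI (H : Ideal (MvPolynomial σ k)) (U : Set σ) (f : Fin s → MvPolynomial σ k) :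
    Ideal (MvPolynomial (Fin s) (Q0 k U)) :=
  Ideal.span (Set.range fun i => C (toQ0 k U (f i)) - X i) ⊔ (ideal0 H U).map C

/-- The lowest degree in `Y` of a term of `g` (and `0` for `g = 0`). -/
def lowestDegree {S : Type*} [CommRing S] (g : MvPolynomial (Fin s) S) : ℕ :=
  sInf (Finsupp.degree '' (g.support : Set (Fin s →₀ ℕ)))

/-- The initial form of `g` with respect to the weight `-1` on the variables `Y` and `0` on the
coefficients: the sum of the terms of `g` of lowest degree in `Y`. -/
def initialForm {S : Type*} [CommRing S] (g : MvPolynomial (Fin s) S) : MvPolynomial (Fin s) S :=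
  homogeneousComponent (lowestDegree g) g

/-- The map `g ↦ g_in`: the initial form of `g`, with coefficients reduced modulo `J⁰`. -/
def initialFormK (J : Ideal (MvPolynomial σ k)) (U : Set σ) (g : MvPolynomial (Fin s) (Q0 k U)) :
    MvPolynomial (Fin s) (Q0 k U ⧸ ideal0 J U) :=
  map (Ideal.Quotient.mk (ideal0 J U)) (initialForm g)

/-- The ideal `𝔍_in` of `(Q⁰ / J⁰)[Y] = K[Y]` generated by all `g_in` with `g ∈ 𝔍`. -/
def idealIn (H J : Ideal (MvPolynomial σ k)) (U : Set σ) (f : Fin s → MvPolynomial σ k) :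
    Ideal (MvPolynomial (Fin s) (Q0 k U ⧸ ideal0 J U)) :=
  Ideal.span (initialFormK J U '' (idealFrakI H U f : Set (MvPolynomial (Fin s) (Q0 k U))))

/-- An ideal of a polynomial ring is generated by linear elements if it has a set of generators
consisting of linear forms (homogeneous polynomials of degree one, or zero). -/
def IsGeneratedByLinear {τ S : Type*} [CommSemiring S] (I : Ideal (MvPolynomial τ S)) : Prop :=
  ∃ G : Set (MvPolynomial τ S), (∀ g ∈ G, g.IsHomogeneous 1) ∧ Ideal.span G = I

end InitialIdeal

end

/-! Write `R` for the local ring `A_L`, with maximal ideal 𝔪 and residue field `K`. Generators `f_i`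
of 𝔪 give a surjection `K[Y] → Gr(R)` sending `Y_i` to the class of `f_i` in 𝔪/𝔪² (`ofForms`). Its
kernel is homogeneous: the reduction of a form `p` of degree `n` over `R` lies in it exactly when
`p(f) ∈ 𝔪^(n+1)`. Two independent facts then give the theorem.

The first (`map_idealIn_eq_ker`) says that, under `Q⁰/J⁰ ≅ K`, the ideal `𝔍_in` is this kernel.
Indeed `𝔍` is the kernel of `Q⁰[Y] → R`, `Y_i ↦ f_i`, so the lowest form of an element of `𝔍` takes
a value in the next power of 𝔪. Conversely, if `g(f) ∈ 𝔪^(n+1)` with `g` a form of degree `n`, then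
`g(f) = p(f)` for a form `p` of degree `n + 1`, and after clearing denominators `g - p` lies in `𝔍`.

The second (`isRegularLocalRing_tfae`) holds for every Noetherian local ring. Its pivot is
`ofForms_injective_iff_le_ringKrullDim`: for `d` generators of 𝔪 the surjection is injective exactly
when `d ≤ dim R`. One direction, `coeff_mem_of_eval_mem`, tests a relation against a valuation for
which one monomial dominates; the other, `le_ringKrullDim_of_forall_coeff_mem`, divides out one
generator at a time. For a minimal system of generators injectivity is therefore regularity. Linear
relations among other generators correspond to eliminating redundant ones, and an abstract
isomorphism of `Gr(R)` with a polynomial ring in `d` variables yields `d` generators of 𝔪 by looking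
at degree one. -/

noncomputable section

open MvPolynomial IsLocalRing

universe u

/-! ### The presentation of the associated graded ring by a polynomial ring -/

namespace AssociatedGraded

variable {R : Type*} [CommRing R] {I : Ideal R}

theorem of_congr {m n : ℕ} {x y : R} {hx : x ∈ I ^ m} {hy : y ∈ I ^ n} (hmn : m = n)
    (hxy : x = y) :
    of I m (GradedPiece.mk I m x hx) = of I n (GradedPiece.mk I n y hy) := by
  subst hmn hxy
  rfl

variable (I) in
/-- The homogeneous component of degree `n`. -/
def component (n : ℕ) : AssociatedGraded I →+ GradedPiece I n :=
  DFinsupp.evalAddMonoidHom (β := GradedPiece I) n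

theorem component_of_same (n : ℕ) (x : GradedPiece I n) : component I n (of I n x) = x :=
  DirectSum.of_eq_same (β := GradedPiece I) n x

theorem component_of_ne {m n : ℕ} (h : m ≠ n) (x : GradedPiece I m) :
    component I n (of I m x) = 0 :=
  DirectSum.of_eq_of_ne (β := GradedPiece I) m n x h.symm

theorem of_mk_eq_zero_iff {n : ℕ} {x : R} (hx : x ∈ I ^ n) :
    of I n (GradedPiece.mk I n x hx) = 0 ↔ x ∈ I ^ (n + 1) := by
  constructor
  · intro h
    have h' := component_of_same n (GradedPiece.mk I n x hx)
    rw [h, map_zero] at h'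
    exact (Submodule.Quotient.mk_eq_zero (Submodule.submoduleOf (I ^ (n + 1)) (I ^ n))).1 h'.symm
  · intro h
    rw [GradedPiece.mk_eq_zero hx h, map_zero]

theorem algebraMap_mk (r : R) :
    algebraMap (R ⧸ I) (AssociatedGraded I) (Ideal.Quotient.mk I r) =
      of I 0 (GradedPiece.mk I 0 r (by simp)) := rfl

theorem of_pow {x : R} (hx : x ∈ I ^ 1) (k : ℕ) :
    of I 1 (GradedPiece.mk I 1 x hx) ^ k =
      of I k (GradedPiece.mk I k (x ^ k) (Ideal.pow_mem_pow (by simpa using hx) k)) := by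
  induction k with
  | zero => rw [pow_zero, ← of_one]; exact of_congr rfl (pow_zero x).symm
  | succ k ih =>
    rw [pow_succ, ih, of_mul_of]
    exact of_congr rfl (pow_succ x k).symm

theorem induction_on {p : AssociatedGraded I → Prop} (a : AssociatedGraded I) (h0 : p 0)
    (hof : ∀ n x hx, p (of I n (GradedPiece.mk I n x hx)))
    (hadd : ∀ a b, p a → p b → p (a + b)) : p a := by
  refine DirectSum.induction_on (motive := p) a h0 (fun n x => ?_) hadd
  induction x using Submodule.Quotient.induction_on with | _ x
  exact hof n x.1 x.2

variable {ι : Type*}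

/-- The algebra homomorphism from the polynomial ring to the associated graded ring which sends
the variables to the classes of given elements of `I` in `I / I ^ 2`. -/
def ofForms (f : ι → R) (hf : ∀ i, f i ∈ I) :
    MvPolynomial ι (R ⧸ I) →ₐ[R ⧸ I] AssociatedGraded I :=
  aeval fun i => of I 1 (GradedPiece.mk I 1 (f i) (by simpa using hf i))

variable {f : ι → R} (hf : ∀ i, f i ∈ I)

theorem ofForms_X (i : ι) :
    ofForms f hf (X i) = of I 1 (GradedPiece.mk I 1 (f i) (by simpa using hf i)) :=
  aeval_X _ _

/-- The class on the right can be formed only once membership in the power of `I` is known, so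
membership and identity are proved in one induction. -/
theorem exists_ofForms_monomial_one (α : ι →₀ ℕ) :
    ∃ h, ofForms f hf (monomial α 1) =
      of I α.degree (GradedPiece.mk I α.degree (eval f (monomial α 1)) h) := by
  induction α using Finsupp.induction_linear with
  | zero =>
    refine ⟨by simp, ?_⟩
    rw [monomial_zero', C_1, map_one, ← of_one]
    exact of_congr (by simp) (by simp)
  | add α β hα hβ =>
    obtain ⟨h1, e1⟩ := hα
    obtain ⟨h2, e2⟩ := hβ
    have e : (monomial (α + β) (1 : R ⧸ I)) = monomial α 1 * monomial β 1 := by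
      rw [monomial_mul, one_mul]
    have e' : (monomial (α + β) (1 : R)) = monomial α 1 * monomial β 1 := by
      rw [monomial_mul, one_mul]
    refine ⟨?_, ?_⟩
    · rw [e', map_mul, map_add]
      exact GradedPiece.mul_mem ⟨_, h1⟩ ⟨_, h2⟩
    · rw [e, map_mul, e1, e2, of_mul_of]
      exact of_congr (map_add _ _ _).symm (by rw [e', map_mul])
  | single i k =>
    refine ⟨?_, ?_⟩
    · simpa [eval_monomial] using Ideal.pow_mem_pow (hf i) k
    · rw [← X_pow_eq_monomial, map_pow, ofForms_X, of_pow]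
      exact of_congr (by simp) (by simp [eval_monomial])

theorem exists_ofForms_map {n : ℕ} {p : MvPolynomial ι R} (hp : p.IsHomogeneous n) :
    ∃ h, ofForms f hf (map (Ideal.Quotient.mk I) p) =
      of I n (GradedPiece.mk I n (eval f p) h) := by
  rw [p.as_sum]
  refine Finset.sum_induction _ (fun q => ∃ h, ofForms f hf (map (Ideal.Quotient.mk I) q) =
      of I n (GradedPiece.mk I n (eval f q) h)) ?_ ?_ ?_
  · rintro a b ⟨ha, ha'⟩ ⟨hb, hb'⟩
    refine ⟨by rw [map_add]; exact add_mem ha hb, ?_⟩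
    rw [map_add, map_add, ha', hb', ← map_add]
    congr 1
    rw [← Submodule.Quotient.mk_add]
    congr 1
    simp
  · refine ⟨by simp, ?_⟩
    rw [map_zero, map_zero, eq_comm, of_mk_eq_zero_iff]
    simp
  · intro α hα
    have hdeg : α.degree = n := hp.degree_eq_sum_deg_support hα |>.symm
    obtain ⟨h1, e1⟩ := exists_ofForms_monomial_one hf α
    have e : monomial α (coeff α p) = C (coeff α p) * monomial α 1 := by
      rw [C_mul_monomial, mul_one]
    subst hdeg
    refine ⟨?_, ?_⟩
    · rw [e, map_mul]
      exact Ideal.mul_mem_left _ _ h1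
    · have e' : map (Ideal.Quotient.mk I) (monomial α (coeff α p)) =
          algebraMap _ _ (Ideal.Quotient.mk I (coeff α p)) * monomial α 1 := by
        rw [e, map_mul, map_C, map_monomial, map_one, algebraMap_eq]
      rw [e', map_mul, e1, AlgHom.commutes, algebraMap_mk, of_mul_of]
      exact of_congr (zero_add _) (by rw [e, map_mul, eval_C])

theorem eval_mem_pow {n : ℕ} {p : MvPolynomial ι R} (hp : p.IsHomogeneous n)
    (hf : ∀ i, f i ∈ I) : eval f p ∈ I ^ n :=
  (exists_ofForms_map hf hp).1

theorem ofForms_map {n : ℕ} {p : MvPolynomial ι R} (hp : p.IsHomogeneous n) :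
    ofForms f hf (map (Ideal.Quotient.mk I) p) =
      of I n (GradedPiece.mk I n (eval f p) (eval_mem_pow hp hf)) :=
  (exists_ofForms_map hf hp).2

theorem ofForms_map_eq_zero_iff {n : ℕ} {p : MvPolynomial ι R} (hp : p.IsHomogeneous n) :
    ofForms f hf (map (Ideal.Quotient.mk I) p) = 0 ↔ eval f p ∈ I ^ (n + 1) := by
  rw [ofForms_map hf hp, of_mk_eq_zero_iff]

theorem _root_.MvPolynomial.map_homogeneousComponent {S T : Type*} [CommSemiring S]
    [CommSemiring T] (g : S →+* T) (n : ℕ) (p : MvPolynomial ι S) :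
    map g (homogeneousComponent n p) = homogeneousComponent n (map g p) := by
  ext α
  simp only [coeff_map, coeff_homogeneousComponent]
  split_ifs <;> simp

theorem _root_.MvPolynomial.IsHomogeneous.exists_map_eq {S T : Type*} [CommSemiring S]
    [CommSemiring T] {g : S →+* T} (hg : Function.Surjective g) {n : ℕ} {p : MvPolynomial ι T}
    (hp : p.IsHomogeneous n) : ∃ q : MvPolynomial ι S, q.IsHomogeneous n ∧ map g q = p := by
  obtain ⟨q, rfl⟩ := map_surjective g hg p
  refine ⟨homogeneousComponent n q, homogeneousComponent_isHomogeneous _ _, ?_⟩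
  rw [map_homogeneousComponent, homogeneousComponent_eq_self hp]

theorem ofForms_homogeneousComponent (n : ℕ) (p : MvPolynomial ι (R ⧸ I)) :
    ofForms f hf (homogeneousComponent n p) = of I n (component I n (ofForms f hf p)) := by
  obtain ⟨q, rfl⟩ := map_surjective _ Ideal.Quotient.mk_surjective p
  have key : ∀ m, ofForms f hf (homogeneousComponent m (map (Ideal.Quotient.mk I) q)) =
      of I m (GradedPiece.mk I m (eval f (homogeneousComponent m q))
        (eval_mem_pow (homogeneousComponent_isHomogeneous m q) hf)) := fun m => by
    rw [← map_homogeneousComponent, ofForms_map hf (homogeneousComponent_isHomogeneous m q)]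
  conv_rhs => rw [← sum_homogeneousComponent (map (Ideal.Quotient.mk I) q)]
  rw [map_sum, map_sum]
  by_cases hn : n ∈ Finset.range ((map (Ideal.Quotient.mk I) q).totalDegree + 1)
  · rw [Finset.sum_eq_single_of_mem n hn, key, component_of_same]
    intro m _ hmn
    rw [key, component_of_ne hmn]
  · rw [homogeneousComponent_eq_zero _ _ (by simpa using hn), map_zero, Finset.sum_eq_zero,
      map_zero]
    intro m hm
    rw [key, component_of_ne]
    rintro rfl
    exact hn hm

/-- The kernel is a homogeneous ideal, since `ofForms` respects degrees; kernel questions thus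
reduce to forms, where `ofForms_map_eq_zero_iff` applies. -/
theorem ofForms_eq_zero_iff (p : MvPolynomial ι (R ⧸ I)) :
    ofForms f hf p = 0 ↔ ∀ n, ofForms f hf (homogeneousComponent n p) = 0 := by
  refine ⟨fun h n => by rw [ofForms_homogeneousComponent, h, map_zero, map_zero], fun h => ?_⟩
  rw [← sum_homogeneousComponent p, map_sum]
  exact Finset.sum_eq_zero fun n _ => h n

theorem ofForms_surjective (hI : Ideal.span (Set.range f) = I) :
    Function.Surjective (ofForms f hf) := by
  intro a
  change a ∈ (ofForms f hf).range
  induction a using induction_on with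
  | h0 => exact zero_mem _
  | hof n x hx =>
    have hx' := hx
    rw [← hI, Ideal.mem_span_pow_iff_exists_isHomogeneous] at hx'
    obtain ⟨p, hp, rfl⟩ := hx'
    exact ⟨_, ofForms_map hf hp⟩
  | hadd a b ha hb => exact add_mem ha hb

/-- Translates injectivity into analytic independence, a condition on forms over `R` that can be
tested by valuations and passed to quotients of `R`. -/
theorem ofForms_injective_iff :
    Function.Injective (ofForms f hf) ↔ ∀ (n : ℕ) (p : MvPolynomial ι R), p.IsHomogeneous n →
      eval f p ∈ I ^ (n + 1) → ∀ α, coeff α p ∈ I := by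
  rw [injective_iff_map_eq_zero]
  constructor
  · intro h n p hp hpe α
    rw [← Ideal.Quotient.eq_zero_iff_mem, ← coeff_map,
      h _ ((ofForms_map_eq_zero_iff hf hp).2 hpe), coeff_zero]
  · intro h p hp
    rw [ofForms_eq_zero_iff] at hp
    rw [← sum_homogeneousComponent p]
    refine Finset.sum_eq_zero fun n _ => ?_
    obtain ⟨q, hq, hqp⟩ := (homogeneousComponent_isHomogeneous n p).exists_map_eq
      (Ideal.Quotient.mk_surjective (I := I))
    have := hp n
    rw [← hqp, ofForms_map_eq_zero_iff hf hq] at this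
    rw [← hqp]
    ext α
    rw [coeff_map, coeff_zero, Ideal.Quotient.eq_zero_iff_mem]
    exact h n q hq this α

end AssociatedGraded

open AssociatedGraded

/-! ### Separating weights and dominating valuations -/

section Valuation

theorem exists_weight_injOn {d : ℕ} (S : Finset (Fin d →₀ ℕ)) :
    ∃ w : Fin d → ℕ, Set.InjOn (fun α : Fin d →₀ ℕ => ∑ i, w i * α i) S := by
  obtain ⟨B, hB⟩ : ∃ B, ∀ α ∈ S, ∀ i, α i < B := by
    refine ⟨(∑ α ∈ S, ∑ i, α i) + 1, fun α hα i => Nat.lt_succ_of_le ?_⟩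
    exact (Finset.single_le_sum (f := fun i => α i) (fun _ _ => Nat.zero_le _)
      (Finset.mem_univ i)).trans
      (Finset.single_le_sum (f := fun α : Fin d →₀ ℕ => ∑ i, α i) (fun _ _ => Nat.zero_le _) hα)
  -- All exponents are below `B`, so the weighted sum is a base-`B` expansion and determines its
  -- digits.
  refine ⟨fun i => B ^ (i : ℕ), fun α hα β hβ h => ?_⟩
  have key : ∀ (e : ℕ) (a b : Fin e → ℕ), (∀ i, a i < B) → (∀ i, b i < B) →
      ∑ i : Fin e, B ^ (i : ℕ) * a i = ∑ i : Fin e, B ^ (i : ℕ) * b i → a = b := by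
    intro e
    induction e with
    | zero => intro a b _ _ _; exact Subsingleton.elim _ _
    | succ e ih =>
      intro a b ha hb hab
      have hs : ∀ c : Fin (e + 1) → ℕ, ∑ i : Fin (e + 1), B ^ (i : ℕ) * c i =
          c 0 + B * ∑ i : Fin e, B ^ (i : ℕ) * c i.succ := by
        intro c
        rw [Fin.sum_univ_succ, Finset.mul_sum]
        simp [pow_succ', mul_assoc]
      rw [hs, hs] at hab
      have h0 : a 0 = b 0 := by
        have := congrArg (· % B) hab
        simpa [Nat.add_mul_mod_self_left, Nat.mod_eq_of_lt, ha 0, hb 0] using this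
      have hBpos : 0 < B := (Nat.zero_le _).trans_lt (ha 0)
      rw [h0] at hab
      have h1 := ih (fun i => a i.succ) (fun i => b i.succ) (fun i => ha _) (fun i => hb _)
        (Nat.eq_of_mul_eq_mul_left hBpos (Nat.add_left_cancel hab))
      funext i
      refine Fin.cases h0 (fun j => ?_) i
      exact congrFun h1 j
  exact DFunLike.coe_injective (key d α β (hB α hα) (hB β hβ) h)

/-- A local ring is dominated by a valuation with any prescribed prime ideal as support. -/
theorem IsLocalRing.exists_valuation {R : Type u} [CommRing R] [IsLocalRing R] (P : Ideal R)
    [P.IsPrime] : ∃ (Γ : Type u) (_ : LinearOrderedCommGroupWithZero Γ) (v : Valuation R Γ),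
      (∀ x, v x ≤ 1) ∧ (∀ x, v x < 1 ↔ x ∈ maximalIdeal R) ∧ ∀ x, v x = 0 ↔ x ∈ P := by
  let F := FractionRing (R ⧸ P)
  let g : R →+* F := (algebraMap (R ⧸ P) F).comp (Ideal.Quotient.mk P)
  -- A valuation ring of `Frac (R / P)` dominating the image of `R`. Its valuation pulled back along
  -- `g` has support `ker g = P`.
  obtain ⟨V, hV, hloc⟩ := (LocalSubring.range g).exists_le_valuationSubring
  have hrange : ∀ x, g x ∈ (LocalSubring.range g).toSubring := fun x => ⟨x, rfl⟩
  have hmem : ∀ x, g x ∈ V := fun x => hV (hrange x)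
  have hle : ∀ x, (V.valuation.comap g) x ≤ 1 := fun x => (V.valuation_le_one_iff _).2 (hmem x)
  refine ⟨V.ValueGroup, inferInstance, V.valuation.comap g, hle, fun x => ?_, fun x => ?_⟩
  · rw [mem_maximalIdeal, mem_nonunits_iff, ← not_iff_not, not_lt, not_not]
    constructor
    · intro h
      have hx : IsUnit (⟨g x, hmem x⟩ : V) := (V.valuation_eq_one_iff _).2 (le_antisymm (hle x) h)
      have hx' := hloc.map_nonunit ⟨g x, hrange x⟩ hx
      obtain ⟨⟨y', y, rfl⟩, hy⟩ := isUnit_iff_exists_inv.1 hx'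
      have hy1 : g (x * y) = 1 := by rw [map_mul]; exact congrArg Subtype.val hy
      by_contra hxu
      -- An inverse in `R / P` suffices: `x * y - 1 ∈ P` lies in the maximal ideal, which then
      -- cannot contain `x`.
      have hxy : x * y - 1 ∈ P := by
        rw [← Ideal.Quotient.eq_zero_iff_mem, ← (IsFractionRing.injective (R ⧸ P) F).eq_iff]
        have : g (x * y - 1) = 0 := by rw [map_sub, hy1, map_one, sub_self]
        rw [map_zero]
        exact this
      have h1 : x * y - 1 ∈ maximalIdeal R := le_maximalIdeal (Ideal.IsPrime.ne_top ‹_›) hxy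
      have h2 : x * y ∈ maximalIdeal R := Ideal.mul_mem_right _ _ ((mem_maximalIdeal x).2 hxu)
      exact (Ideal.ne_top_iff_one _).1 (Ideal.IsPrime.ne_top (maximalIdeal.isMaximal R).isPrime)
        (by simpa using sub_mem h2 h1)
    · intro hx
      have h1 : V.valuation (g x) * V.valuation (g ↑hx.unit⁻¹) = 1 := by
        rw [← map_mul, ← map_mul, IsUnit.mul_val_inv, map_one, map_one]
      by_contra! hlt
      have : V.valuation (g x) * V.valuation (g ↑hx.unit⁻¹) < 1 :=
        mul_lt_one_of_lt_of_le hlt (hle _)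
      exact this.ne h1
  · rw [Valuation.comap_apply, map_eq_zero, RingHom.comp_apply,
      map_eq_zero_iff _ (IsFractionRing.injective (R ⧸ P) F), Ideal.Quotient.eq_zero_iff_mem]

end Valuation

/-! ### Analytic independence from a bound on the dimension -/

section QuasiRegular

variable {R : Type*} [CommRing R] [IsLocalRing R] [IsNoetherianRing R]

/-- A system of `d` generators of the maximal ideal of a Noetherian local ring of dimension at
least `d` is analytically independent. -/
theorem coeff_mem_of_eval_mem {d : ℕ} {t : Fin d → R}
    (ht : Ideal.span (Set.range t) = maximalIdeal R)
    (hd : (d : WithBot ℕ∞) ≤ ringKrullDim R) {n : ℕ} {p : MvPolynomial (Fin d) R}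
    (hp : p.IsHomogeneous n) (hpe : eval t p ∈ maximalIdeal R ^ (n + 1)) (α : Fin d →₀ ℕ) :
    coeff α p ∈ maximalIdeal R := by
  classical
  have htm : ∀ i, t i ∈ maximalIdeal R := fun i => by
    rw [← ht]; exact Ideal.subset_span ⟨i, rfl⟩
  by_contra hα
  -- Without generators there is no `t 0` to compare with, and `p` is a constant.
  rcases d with _ | d
  · obtain rfl : α = 0 := Subsingleton.elim _ _
    have hn : (0 : Fin 0 →₀ ℕ).degree = n := by
      by_contra h
      exact hα (by rw [hp.coeff_eq_zero h]; exact zero_mem _)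
    obtain rfl : n = 0 := by simpa using hn.symm
    have e : eval t p = coeff 0 p := by
      rw [eval_eq]
      rw [Finset.sum_eq_single 0]
      · simp
      · intro b _ hb; exact absurd (Subsingleton.elim _ _) hb
      · intro h; simpa using h
    rw [e, zero_add, pow_one] at hpe
    exact hα hpe
  let S := p.support.filter fun α => coeff α p ∉ maximalIdeal R
  have hSne : S.Nonempty := by
    refine ⟨α, Finset.mem_filter.2 ⟨mem_support_iff.2 fun h => hα ?_, hα⟩⟩
    rw [h]; exact zero_mem _
  -- Among the terms with unit coefficient, `β` is the one of least weight. It will be the dominant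
  -- term.
  obtain ⟨w, hw⟩ := exists_weight_injOn S
  obtain ⟨β, hβS, hβmin⟩ := S.exists_min_image (fun α => ∑ i, w i * α i) hSne
  have hβ := (Finset.mem_filter.1 hβS).2
  -- `M` exceeds the weight of `β`, so that `M * n + weight β < M * (n + 1)`: elements of 𝔪^(n+1)
  -- will be smaller than the `β` term.
  let M := (∑ i, w i * β i) + 1
  let e : Fin (d + 1) → ℕ := fun i => M + w i
  have he0 : e 0 ≠ 0 := by simp [e, M]
  -- a prime ideal containing the differences `t i ^ e 0 - t 0 ^ e i`
  let g : Fin d → R := fun i => t i.succ ^ e 0 - t 0 ^ e i.succ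
  obtain ⟨P, hPmin⟩ := Ideal.nonempty_minimalPrimes (I := Ideal.span (Set.range g)) (by
    intro h
    have : Ideal.span (Set.range g) ≤ maximalIdeal R := by
      rw [Ideal.span_le]
      rintro _ ⟨i, rfl⟩
      exact sub_mem (Ideal.pow_mem_of_mem _ (htm _) _ (Nat.pos_of_ne_zero he0))
        (Ideal.pow_mem_of_mem _ (htm _) _ (by simp [e, M]))
    rw [h, top_le_iff] at this
    exact (maximalIdeal.isMaximal R).ne_top this)
  have hPprime : P.IsPrime := hPmin.1.1
  -- Krull's height theorem: `P` is minimal over `d` elements, whereas the maximal ideal has height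
  -- at least `d + 1`.
  have hPne : P ≠ maximalIdeal R := by
    rintro rfl
    have h1 := Ideal.height_le_card_of_mem_minimalPrimes_span (Set.finite_range g) hPmin
    have h2 : (Set.range g).ncard ≤ d := by
      rw [← Set.image_univ]
      exact (Set.ncard_image_le Set.finite_univ).trans (by simp [Set.ncard_univ])
    rw [← maximalIdeal_height_eq_ringKrullDim] at hd
    have h3 : ((d + 1 : ℕ) : ℕ∞) ≤ (maximalIdeal R).height := by exact_mod_cast hd
    have h4 := h3.trans (h1.trans (Nat.cast_le.2 h2))
    exact absurd (Nat.cast_le.1 h4) (by omega)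
  obtain ⟨Γ, _, v, hv1, hvm, hvP⟩ := IsLocalRing.exists_valuation P
  -- The difference of the two powers lies in the support `P`, so `t i` behaves like an element of
  -- order proportional to `e i`.
  have hrel : ∀ i, v (t i) ^ e 0 = v (t 0) ^ e i := by
    intro i
    refine Fin.cases rfl (fun j => ?_) i
    have hg : g j ∈ P := hPmin.1.2 (Ideal.subset_span ⟨j, rfl⟩)
    have hg0 := (hvP _).2 hg
    rw [← map_pow, ← map_pow]
    have : t j.succ ^ e 0 = g j + t 0 ^ e j.succ := by simp [g]
    rw [this]
    by_cases h0 : v (t 0 ^ e j.succ) = 0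
    · refine le_antisymm ((v.map_add _ _).trans (by rw [hg0, h0, max_self])) (by rw [h0]; simp)
    · rw [v.map_add_eq_of_lt_right (by rw [hg0]; exact zero_lt_iff.2 h0)]
  -- Otherwise `hrel` would put every `t i` into `P`, forcing `P` to be maximal.
  have hρ0 : 0 < v (t 0) := by
    rw [zero_lt_iff]
    intro h0
    refine hPne (le_antisymm (le_maximalIdeal hPprime.ne_top) ?_)
    rw [← ht, Ideal.span_le]
    rintro _ ⟨i, rfl⟩
    have := hrel i
    rw [h0, zero_pow (by simp [e, M])] at this
    exact (hvP _).1 (pow_eq_zero_iff he0 |>.1 this)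
  have hρ1 : v (t 0) < 1 := (hvm _).2 (htm 0)
  have hmon : ∀ γ : Fin (d + 1) →₀ ℕ,
      v (∏ i, t i ^ γ i) ^ e 0 = v (t 0) ^ (M * γ.degree + ∑ i, w i * γ i) := by
    intro γ
    rw [map_prod, ← Finset.prod_pow, Finsupp.degree_eq_sum, Finset.mul_sum,
      ← Finset.sum_add_distrib, ← Finset.prod_pow_eq_pow_sum]
    refine Finset.prod_congr rfl fun i _ => ?_
    rw [map_pow, ← pow_mul, mul_comm, pow_mul, hrel, ← pow_mul]
    congr 1
    simp only [e]; ring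
  -- elements of powers of the maximal ideal have small valuation
  have hpow : ∀ (k : ℕ) (x : R), x ∈ maximalIdeal R ^ k → v x ^ e 0 ≤ v (t 0) ^ (M * k) := by
    intro k x hx
    rw [← ht, Ideal.mem_span_pow_iff_exists_isHomogeneous] at hx
    obtain ⟨q, hq, rfl⟩ := hx
    rw [eval_eq']
    refine Finset.sum_induction _ (fun y => v y ^ e 0 ≤ v (t 0) ^ (M * k)) ?_ ?_ ?_
    · intro a b ha hb
      rcases le_total (v a) (v b) with h | h
      · exact (pow_le_pow_left₀ zero_le (v.map_add_le h le_rfl) _).trans hb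
      · exact (pow_le_pow_left₀ zero_le (v.map_add_le le_rfl h) _).trans ha
    · rw [map_zero, zero_pow he0]; exact zero_le
    · intro γ hγ
      rw [map_mul, mul_pow, hmon]
      have hdeg : γ.degree = k := (hq.degree_eq_sum_deg_support hγ).symm
      rw [hdeg]
      exact (mul_le_of_le_one_left' (pow_le_one₀ zero_le (hv1 _))).trans
        (pow_le_pow_of_le_one zero_le hρ1.le (Nat.le_add_right _ _))
  have hβn : β.degree = n :=
    (hp.degree_eq_sum_deg_support (Finset.mem_filter.1 hβS).1).symm
  have hβv : v (coeff β p * ∏ i, t i ^ β i) ^ e 0 = v (t 0) ^ (M * n + ∑ i, w i * β i) := by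
    have : v (coeff β p) = 1 := le_antisymm (hv1 _) (not_lt.1 fun h => hβ ((hvm _).1 h))
    rw [map_mul, this, one_mul, hmon, hβn]
  have hbig : ∀ k, M * n + M ≤ k → v (t 0) ^ k < v (coeff β p * ∏ i, t i ^ β i) ^ e 0 := by
    intro k hk
    rw [hβv]
    exact pow_lt_pow_right_of_lt_one₀ hρ0 hρ1 (by simp only [M] at hk ⊢; omega)
  have hlt : ∀ γ ∈ p.support.erase β,
      v (coeff γ p * ∏ i, t i ^ γ i) < v (coeff β p * ∏ i, t i ^ β i) := by
    intro γ hγ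
    rw [Finset.mem_erase] at hγ
    have hγn : γ.degree = n := (hp.degree_eq_sum_deg_support hγ.2).symm
    -- A term with coefficient in 𝔪 lies in 𝔪^(n+1). A term with unit coefficient has the same
    -- degree as `β` but strictly larger weight, weights being injective on `S`.
    refine lt_of_pow_lt_pow_left₀ (e 0) zero_le ?_
    by_cases hγm : coeff γ p ∈ maximalIdeal R
    · refine lt_of_le_of_lt ?_ (hbig (M * (n + 1)) (by rw [mul_add, mul_one]))
      refine hpow (n + 1) _ ?_
      rw [pow_succ']
      refine Ideal.mul_mem_mul hγm ?_
      have := AssociatedGraded.eval_mem_pow (isHomogeneous_monomial (1 : R) hγn) htm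
      simpa [eval_monomial, Finsupp.prod_fintype] using this
    · have hγS : γ ∈ S := Finset.mem_filter.2 ⟨hγ.2, hγm⟩
      rw [hβv, map_mul, mul_pow, hmon, hγn]
      refine (mul_le_of_le_one_left' (pow_le_one₀ zero_le (hv1 _))).trans_lt ?_
      refine pow_lt_pow_right_of_lt_one₀ hρ0 hρ1 (Nat.add_lt_add_left ?_ _)
      exact lt_of_le_of_ne (hβmin γ hγS) fun h => hγ.1 (hw hγS hβS h.symm)
  have hne : v (coeff β p * ∏ i, t i ^ β i) ≠ 0 := fun h => by
    have := hbig _ le_rfl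
    rw [h, zero_pow he0] at this
    exact absurd this (not_lt.2 zero_le)
  -- The `β` term is a combination of elements of strictly smaller value, which contradicts the
  -- ultrametric inequality.
  have hsum : coeff β p * ∏ i, t i ^ β i =
      eval t p - ∑ γ ∈ p.support.erase β, coeff γ p * ∏ i, t i ^ γ i := by
    rw [eval_eq', ← Finset.add_sum_erase _ _ (Finset.mem_filter.1 hβS).1, add_sub_cancel_right]
  refine lt_irrefl (v (coeff β p * ∏ i, t i ^ β i)) ?_
  conv_lhs => rw [hsum]
  refine (v.map_sub _ _).trans_lt (max_lt ?_ (v.map_sum_lt hne hlt))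
  exact lt_of_pow_lt_pow_left₀ (e 0) zero_le
    ((hpow _ _ hpe).trans_lt (hbig (M * (n + 1)) (by rw [mul_add, mul_one])))

end QuasiRegular

/-- The kernels of the iterates stabilize, say at `n`. An element of `ker g` is `g^n y`, so `y ∈ ker
g^(n+1) = ker g^n`. -/
theorem RingHom.injective_of_surjective_of_isNoetherianRing {S : Type*} [CommRing S]
    [IsNoetherianRing S] (g : S →+* S) (hg : Function.Surjective g) : Function.Injective g := by
  have hmono : Monotone fun n => RingHom.ker (g ^ n) := by
    refine monotone_nat_of_le_succ fun n x hx => ?_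
    rw [RingHom.mem_ker] at hx ⊢
    rw [pow_succ', RingHom.mul_def, RingHom.comp_apply, hx, map_zero]
  obtain ⟨n, hn⟩ := monotone_stabilizes_iff_noetherian.2 (inferInstanceAs (IsNoetherian S S))
    ⟨_, hmono⟩
  have hn' : RingHom.ker (g ^ n) = RingHom.ker (g ^ (n + 1)) := hn (n + 1) n.le_succ
  have hsurj : Function.Surjective (g ^ n) := by
    rw [RingHom.coe_pow]
    exact hg.iterate n
  rw [injective_iff_map_eq_zero]
  intro x hx
  obtain ⟨y, rfl⟩ := hsurj x
  have : y ∈ RingHom.ker (g ^ (n + 1)) := by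
    rw [RingHom.mem_ker, pow_succ', RingHom.mul_def, RingHom.comp_apply, hx]
  rwa [← hn'] at this

/-! ### Degree-one components and change of generators -/

namespace AssociatedGraded

variable {R : Type*} [CommRing R] {I : Ideal R}

theorem mk_eq_mk_iff {n : ℕ} {x y : R} (hx : x ∈ I ^ n) (hy : y ∈ I ^ n) :
    GradedPiece.mk I n x hx = GradedPiece.mk I n y hy ↔ x - y ∈ I ^ (n + 1) :=
  Submodule.Quotient.eq (Submodule.submoduleOf (I ^ (n + 1)) (I ^ n))

/-- A Leibniz rule. It controls degree-one parts under algebra isomorphisms that need not respect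
the grading. -/
theorem component_one_mul (a b : AssociatedGraded I) :
    component I 1 (a * b) = GradedPiece.mulMap I 0 1 (component I 0 a) (component I 1 b) +
      GradedPiece.mulMap I 1 0 (component I 1 a) (component I 0 b) := by
  induction a using induction_on with
  | h0 => simp
  | hadd a a' ha ha' =>
    simp only [add_mul, map_add, ha, ha', LinearMap.add_apply]
    abel
  | hof n x hx =>
    induction b using induction_on with
    | h0 => simp
    | hadd b b' hb hb' =>
      rw [mul_add, map_add, hb, hb', map_add, map_add, map_add, map_add]
      abel
    | hof m y hy =>
      rw [of_mul_of]
      match n, m, hx, hy with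
      | 0, 0, hx, hy =>
        rw [component_of_ne (by simp), component_of_ne (m := 0) (n := 1) (by simp),
          component_of_ne (m := 0) (n := 1) (by simp), map_zero, LinearMap.map_zero₂, add_zero]
      | 0, 1, hx, hy =>
        rw [component_of_same, component_of_same, component_of_ne (m := 0) (n := 1) (by simp),
          LinearMap.map_zero₂, add_zero]
        exact component_of_same 1 _
      | 1, 0, hx, hy =>
        rw [component_of_same, component_of_same, component_of_ne (m := 0) (n := 1) (by simp),
          map_zero, zero_add]
        exact component_of_same 1 _
      | 1, m + 1, hx, hy =>
        rw [component_of_ne (by omega), component_of_ne (m := 1) (n := 0) (by simp),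
          component_of_ne (m := m + 1) (n := 0) (by simp), map_zero, LinearMap.zero_apply, map_zero,
          add_zero]
      | 0, m + 2, hx, hy =>
        rw [component_of_ne (by omega), component_of_ne (m := m + 2) (n := 1) (by simp),
          component_of_ne (m := m + 2) (n := 0) (by simp), map_zero, map_zero, add_zero]
      | n + 2, m, hx, hy =>
        rw [component_of_ne (by omega), component_of_ne (m := n + 2) (n := 1) (by simp),
          component_of_ne (m := n + 2) (n := 0) (by simp), LinearMap.map_zero₂,
          LinearMap.map_zero₂, add_zero]

theorem component_one_mul_eq_mk {a b : AssociatedGraded I} {r r' y y' : R} {hr : r ∈ I ^ 0}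
    {hr' : r' ∈ I ^ 0} {hy : y ∈ I ^ 1} {hy' : y' ∈ I ^ 1}
    (ha : component I 0 a = GradedPiece.mk I 0 r hr)
    (ha' : component I 1 a = GradedPiece.mk I 1 y hy)
    (hb : component I 0 b = GradedPiece.mk I 0 r' hr')
    (hb' : component I 1 b = GradedPiece.mk I 1 y' hy') :
    component I 1 (a * b) = GradedPiece.mk I 1 (r * y' + y * r')
      (add_mem (Ideal.mul_mem_left _ _ hy') (Ideal.mul_mem_right _ _ hy)) := by
  rw [component_one_mul, ha, ha', hb, hb']
  rfl

/-- Change of generators induces a graded homomorphism between the polynomial rings. -/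
theorem exists_ofForms_comp_eq {ι κ : Type*} {f : ι → R} (hf : ∀ i, f i ∈ I) {t : κ → R}
    (ht : ∀ i, t i ∈ I) (hI : Ideal.span (Set.range t) = I) :
    ∃ T : MvPolynomial ι (R ⧸ I) →ₐ[R ⧸ I] MvPolynomial κ (R ⧸ I),
      (∀ n p, p.IsHomogeneous n → (T p).IsHomogeneous n) ∧
        ∀ p, ofForms t ht (T p) = ofForms f hf p := by
  have h : ∀ i, ∃ p : MvPolynomial κ R, p.IsHomogeneous 1 ∧ eval t p = f i := fun i => by
    rw [← Ideal.mem_span_iff_exists_isHomogeneous, hI]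
    exact hf i
  choose l hl hlf using h
  refine ⟨aeval fun i => map (Ideal.Quotient.mk I) (l i), fun n p hp => ?_, fun p => ?_⟩
  · simpa using hp.aeval _ fun i => (hl i).map (Ideal.Quotient.mk I)
  · have : (ofForms t ht).comp (aeval fun i => map (Ideal.Quotient.mk I) (l i)) =
        ofForms f hf := by
      refine MvPolynomial.algHom_ext fun i => ?_
      rw [AlgHom.comp_apply, aeval_X, ofForms_map ht (hl i), ofForms_X]
      exact of_congr rfl (hlf i)
    exact DFunLike.congr_fun this p

/-- Express the `f`'s through the `t`'s (`T`) and back (`S`). Modulo the linear forms `X i - S (T (X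
i))` every `p` agrees with `S (T p)`, and `T` kills the kernel because `ofForms t` is injective. -/
theorem isGeneratedByLinear_ker_ofForms {ι κ : Type*} {f : ι → R} (hf : ∀ i, f i ∈ I)
    (hfI : Ideal.span (Set.range f) = I) {t : κ → R} (ht : ∀ i, t i ∈ I)
    (htI : Ideal.span (Set.range t) = I) (hinj : Function.Injective (ofForms t ht)) :
    IsGeneratedByLinear (RingHom.ker (ofForms f hf)) := by
  obtain ⟨T, hT, hTf⟩ := exists_ofForms_comp_eq hf ht htI
  obtain ⟨S, hS, hSf⟩ := exists_ofForms_comp_eq ht hf hfI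
  refine ⟨Set.range fun i => X i - S (T (X i)), ?_, le_antisymm ?_ fun p hp => ?_⟩
  · rintro _ ⟨i, rfl⟩
    exact (isHomogeneous_X _ i).sub (hS _ _ (hT _ _ (isHomogeneous_X _ i)))
  · rw [Ideal.span_le]
    rintro _ ⟨i, rfl⟩
    simp [RingHom.mem_ker, hSf, hTf]
  · set J := Ideal.span (Set.range fun i => X i - S (T (X i)))
    have h : (Ideal.Quotient.mkₐ (R ⧸ I) J).comp (S.comp T) = Ideal.Quotient.mkₐ (R ⧸ I) J := by
      refine MvPolynomial.algHom_ext fun i => ?_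
      rw [eq_comm]
      exact (Ideal.Quotient.mk_eq_mk_iff_sub_mem _ _).2 (Ideal.subset_span ⟨i, rfl⟩)
    have hp' := DFunLike.congr_fun h p
    have hTp : T p = 0 := hinj (by rw [hTf, map_zero]; exact hp)
    rw [AlgHom.comp_apply, AlgHom.comp_apply, hTp, map_zero, map_zero] at hp'
    exact Ideal.Quotient.eq_zero_iff_mem.1 hp'.symm

end AssociatedGraded

/-! ### A bound on the dimension from analytic independence -/

section QuasiRegular

/-- The class of `t i` is a variable of the polynomial ring `Gr`, hence a nonzerodivisor there:
multiplication by `X i` only shifts coefficients. -/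
theorem mem_pow_of_mul_mem_pow {R : Type*} [CommRing R] {I : Ideal R} {ι : Type*} {t : ι → R}
    (htI : Ideal.span (Set.range t) = I)
    (h : ∀ (n : ℕ) (p : MvPolynomial ι R), p.IsHomogeneous n →
      eval t p ∈ I ^ (n + 1) → ∀ α, coeff α p ∈ I) (i : ι) (j : ℕ) :
    ∀ c, t i * c ∈ I ^ (j + 1) → c ∈ I ^ j := by
  have htm : ∀ i, t i ∈ I := fun i => by rw [← htI]; exact Ideal.subset_span ⟨i, rfl⟩
  induction j with
  | zero => simp
  | succ j ih =>
    intro c hc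
    have hcj := ih c (Ideal.pow_le_pow_right (Nat.le_succ _) hc)
    rw [← htI, Ideal.mem_span_pow_iff_exists_isHomogeneous] at hcj
    obtain ⟨p, hp, rfl⟩ := hcj
    rw [← ofForms_map_eq_zero_iff htm hp]
    convert map_zero (ofForms t htm)
    ext α
    rw [coeff_map, coeff_zero, Ideal.Quotient.eq_zero_iff_mem, ← coeff_X_mul α i p]
    refine h (j + 1) _ (by rw [add_comm]; exact (isHomogeneous_X R i).mul hp) ?_ _
    rwa [map_mul, eval_X]

/-- If the maximal ideal of a Noetherian local ring is generated by `d` analytically independent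
elements, then the dimension of the ring is at least `d`. -/
theorem le_ringKrullDim_of_forall_coeff_mem {d : ℕ} {R : Type u} [CommRing R] [IsLocalRing R]
    [IsNoetherianRing R] {t : Fin d → R} (ht : Ideal.span (Set.range t) = maximalIdeal R)
    (h : ∀ (n : ℕ) (p : MvPolynomial (Fin d) R), p.IsHomogeneous n →
      eval t p ∈ maximalIdeal R ^ (n + 1) → ∀ α, coeff α p ∈ maximalIdeal R) :
    (d : WithBot ℕ∞) ≤ ringKrullDim R := by
  induction d generalizing R with
  | zero => simpa using ringKrullDim_nonneg_of_nontrivial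
  | succ d ih =>
    have htm : ∀ i, t i ∈ maximalIdeal R := fun i => by
      rw [← ht]; exact Ideal.subset_span ⟨i, rfl⟩
    have hpow := mem_pow_of_mul_mem_pow ht h 0
    -- An annihilator of `t 0` lies in every power of the maximal ideal, so Krull's intersection
    -- theorem applies.
    have hreg : t 0 ∈ nonZeroDivisors R := by
      rw [mem_nonZeroDivisors_iff_right]
      intro c hc
      have : c ∈ ⨅ j, maximalIdeal R ^ j := by
        rw [Ideal.mem_iInf]
        intro j
        refine hpow j c ?_
        rw [mul_comm, hc]
        exact zero_mem _
      rwa [Ideal.iInf_pow_eq_bot_of_isLocalRing _ (maximalIdeal.isMaximal R).ne_top] at this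
    set q := Ideal.span {t 0} with hq
    have hqm : q ≤ maximalIdeal R := by
      rw [hq, Ideal.span_singleton_le_iff_mem]
      exact htm 0
    have : Nontrivial (R ⧸ q) :=
      Ideal.Quotient.nontrivial_iff.2 fun h => (maximalIdeal.isMaximal R).ne_top
        (top_le_iff.1 (h ▸ hqm))
    have hloc : IsLocalRing (R ⧸ q) :=
      IsLocalRing.of_surjective' (Ideal.Quotient.mk q) Ideal.Quotient.mk_surjective
    have hmax : (maximalIdeal R).map (Ideal.Quotient.mk q) = maximalIdeal (R ⧸ q) := by
      have h1 := Ideal.comap_isMaximal_of_surjective (Ideal.Quotient.mk q)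
        Ideal.Quotient.mk_surjective (K := maximalIdeal (R ⧸ q))
      rw [← eq_maximalIdeal h1, Ideal.map_comap_of_surjective _ Ideal.Quotient.mk_surjective]
    have hspan : Ideal.span (Set.range fun i : Fin d => Ideal.Quotient.mk q (t i.succ)) =
        maximalIdeal (R ⧸ q) := by
      rw [← hmax]
      apply le_antisymm
      · rw [Ideal.span_le]
        rintro _ ⟨i, rfl⟩
        exact Ideal.mem_map_of_mem _ (htm _)
      · rw [← ht, Ideal.map_span, Ideal.span_le]
        rintro _ ⟨_, ⟨i, rfl⟩, rfl⟩
        refine Fin.cases ?_ (fun j => ?_) i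
        · rw [Ideal.Quotient.eq_zero_iff_mem.2 (Ideal.mem_span_singleton_self (t 0))]
          exact zero_mem _
        · exact Ideal.subset_span ⟨j, rfl⟩
    have key := ih hspan ?_
    · refine le_trans ?_ (ringKrullDim_quotient_succ_le_of_nonZeroDivisor hreg)
      rw [Nat.cast_add, Nat.cast_one]
      gcongr
    · intro n p' hp' hpe α
      obtain ⟨p, hp, rfl⟩ := hp'.exists_map_eq (Ideal.Quotient.mk_surjective (I := q))
      rw [coeff_map, ← hmax]
      refine Ideal.mem_map_of_mem _ ?_
      have hev : eval (fun i : Fin d => Ideal.Quotient.mk q (t i.succ))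
          (map (Ideal.Quotient.mk q) p) = Ideal.Quotient.mk q (eval t (rename Fin.succ p)) := by
        rw [eval_rename, eval_map, eval₂_comp]
        rfl
      rw [hev, ← hmax, ← Ideal.map_pow, Ideal.mem_map_iff_of_surjective _
        Ideal.Quotient.mk_surjective] at hpe
      obtain ⟨y, hy, hye⟩ := hpe
      obtain ⟨c, hc⟩ := Ideal.mem_span_singleton'.1 (Ideal.Quotient.eq.1 hye.symm)
      have hpr : (rename Fin.succ p : MvPolynomial (Fin (d + 1)) R).IsHomogeneous n :=
        hp.rename_isHomogeneous
      rw [← coeff_rename_mapDomain Fin.succ (Fin.succ_injective d)]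
      -- In degree zero nothing is needed about `c`, since `c * t 0` is already in the maximal
      -- ideal.
      rcases n with _ | n
      · refine h 0 _ hpr ?_ _
        rw [← sub_add_cancel (eval t (rename Fin.succ p)) y, ← hc]
        refine add_mem ?_ hy
        rw [zero_add, pow_one]
        exact Ideal.mul_mem_left _ _ (htm 0)
      · have hcn : c ∈ maximalIdeal R ^ n := by
          refine hpow n c ?_
          rw [mul_comm, hc]
          exact sub_mem (eval_mem_pow hpr htm) (Ideal.pow_le_pow_right (Nat.le_succ _) hy)
        rw [← ht, Ideal.mem_span_pow_iff_exists_isHomogeneous] at hcn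
        obtain ⟨r, hr, rfl⟩ := hcn
        -- Correcting by `X 0 * r` makes the value lie in the next power, and leaves untouched the
        -- coefficients of monomials not involving `X 0`.
        have h1 := h (n + 1) (rename Fin.succ p - X 0 * r)
          (hpr.sub (by simpa only [add_comm] using (isHomogeneous_X R (0 : Fin (d + 1))).mul hr))
          (by
            rw [map_sub, map_mul, eval_X, mul_comm, hc, sub_sub_cancel]
            exact hy) (α.mapDomain Fin.succ)
        rw [coeff_sub, mul_comm, coeff_mul_X', if_neg, sub_zero] at h1
        · exact h1
        · rw [Finsupp.notMem_support_iff, Finsupp.mapDomain_of_notMem_range]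
          simp

/-! ### Regularity of Noetherian local rings -/

variable {R : Type u} [CommRing R] [IsLocalRing R] [IsNoetherianRing R]

theorem exists_fin_span_range_eq_maximalIdeal (R : Type*) [CommRing R] [IsLocalRing R]
    [IsNoetherianRing R] : ∃ t : Fin (maximalIdeal R).spanFinrank → R,
      Ideal.span (Set.range t) = maximalIdeal R := by
  obtain ⟨s, hs, hspan⟩ :=
    Submodule.FG.exists_span_finset_card_eq_spanFinrank (maximalIdeal R).fg_of_isNoetherianRing
  refine ⟨fun i => s.equivFin.symm (Fin.cast hs.symm i), ?_⟩
  refine Eq.trans (congrArg Ideal.span ?_) hspan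
  ext x
  constructor
  · rintro ⟨i, rfl⟩
    exact Subtype.coe_prop _
  · intro hx
    exact ⟨Fin.cast hs (s.equivFin ⟨x, hx⟩), by simp⟩

/-- If `c i` were a unit, `t i` would be redundant modulo 𝔪², hence redundant by Nakayama, against
minimality of the number of generators. -/
theorem mem_maximalIdeal_of_sum_mem_sq {t : Fin (maximalIdeal R).spanFinrank → R}
    (ht : Ideal.span (Set.range t) = maximalIdeal R) {c : Fin (maximalIdeal R).spanFinrank → R}
    (hc : ∑ i, c i * t i ∈ maximalIdeal R ^ 2) (i : Fin (maximalIdeal R).spanFinrank) :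
    c i ∈ maximalIdeal R := by
  classical
  by_contra hi
  obtain ⟨u, hu⟩ : IsUnit (c i) := by simpa using hi
  set N := Ideal.span (t '' {i}ᶜ)
  have hle : maximalIdeal R ≤ N ⊔ maximalIdeal R • maximalIdeal R := by
    conv_lhs => rw [← ht]
    rw [Ideal.span_le]
    rintro _ ⟨j, rfl⟩
    by_cases hj : j = i
    · subst hj
      have e : t j = ↑u⁻¹ * (∑ i, c i * t i) - ↑u⁻¹ * ∑ i ∈ Finset.univ.erase j, c i * t i := by
        rw [← mul_sub, ← Finset.add_sum_erase _ _ (Finset.mem_univ j), add_sub_cancel_right, ← hu,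
          Units.inv_mul_cancel_left]
      rw [e]
      refine sub_mem (Ideal.mul_mem_left _ _ (Ideal.mem_sup_right ?_))
        (Ideal.mul_mem_left _ _ (Ideal.mem_sup_left ?_))
      · rwa [smul_eq_mul, ← pow_two]
      · refine sum_mem fun l hl => Ideal.mul_mem_left _ _ (Ideal.subset_span ⟨l, ?_, rfl⟩)
        simpa using hl
    · exact Ideal.mem_sup_left (Ideal.subset_span ⟨j, hj, rfl⟩)
  have hle' : maximalIdeal R ≤ N := Submodule.le_of_le_smul_of_le_jacobson_bot
    (maximalIdeal R).fg_of_isNoetherianRing (maximalIdeal_le_jacobson _) hle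
  have hN : N = maximalIdeal R := by
    refine le_antisymm ?_ hle'
    rw [← ht]
    exact Ideal.span_mono (Set.image_subset_range _ _)
  have h1 : (maximalIdeal R).spanFinrank ≤ (t '' {i}ᶜ).ncard := by
    conv_lhs => rw [← hN]
    exact Submodule.spanFinrank_span_le_ncard_of_finite (Set.toFinite _)
  have h2 : (t '' {i}ᶜ).ncard ≤ ({i}ᶜ : Set (Fin (maximalIdeal R).spanFinrank)).ncard :=
    Set.ncard_image_le (Set.toFinite _)
  rw [Set.ncard_compl, Set.ncard_singleton, Nat.card_eq_fintype_card, Fintype.card_fin] at h2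
  have := i.2
  omega

theorem ofForms_injective_iff_le_ringKrullDim {d : ℕ} {t : Fin d → R}
    (htm : ∀ i, t i ∈ maximalIdeal R) (ht : Ideal.span (Set.range t) = maximalIdeal R) :
    Function.Injective (ofForms t htm) ↔ (d : WithBot ℕ∞) ≤ ringKrullDim R := by
  rw [ofForms_injective_iff]
  exact ⟨le_ringKrullDim_of_forall_coeff_mem ht, fun hd _ _ => coeff_mem_of_eval_mem ht hd⟩

/-- For minimal generators `t` no nonzero linear form lies in the kernel. Hence the substitution `T`
from `f` to `t` kills the linear generators of `ker (ofForms f)`, thus all of it, while `S` is a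
section of `T` carrying `ker (ofForms t)` into it. -/
theorem IsRegularLocalRing.of_isGeneratedByLinear {ι : Type*} {f : ι → R}
    (hf : ∀ i, f i ∈ maximalIdeal R) (hfm : Ideal.span (Set.range f) = maximalIdeal R)
    (h : IsGeneratedByLinear (RingHom.ker (ofForms f hf))) : IsRegularLocalRing R := by
  obtain ⟨G, hG, hGker⟩ := h
  obtain ⟨t, ht⟩ := exists_fin_span_range_eq_maximalIdeal R
  have htm : ∀ i, t i ∈ maximalIdeal R := fun i => by
    rw [← ht]; exact Ideal.subset_span ⟨i, rfl⟩
  refine IsRegularLocalRing.of_spanFinrank_maximalIdeal_le R ?_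
  rw [← ofForms_injective_iff_le_ringKrullDim htm ht]
  obtain ⟨T, hT, hTf⟩ := exists_ofForms_comp_eq hf htm ht
  obtain ⟨S, hS, hSf⟩ := exists_ofForms_comp_eq htm hf hfm
  have hlin : ∀ g, g.IsHomogeneous 1 → ofForms t htm g = 0 → g = 0 := by
    intro g hg hg0
    rw [← mem_homogeneousSubmodule, homogeneousSubmodule_one_eq_span_X,
      Submodule.mem_span_range_iff_exists_fun] at hg
    obtain ⟨c, rfl⟩ := hg
    choose b hb using fun i => Ideal.Quotient.mk_surjective (c i)
    have e : ∑ i, c i • X i = map (Ideal.Quotient.mk (maximalIdeal R)) (∑ i, C (b i) * X i) := by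
      simp [hb, smul_eq_C_mul]
    have hhom : (∑ i, C (b i) * X i : MvPolynomial _ R).IsHomogeneous 1 :=
      IsHomogeneous.sum _ _ _ fun i _ => isHomogeneous_C_mul_X _ _
    rw [e, ofForms_map_eq_zero_iff htm hhom] at hg0
    refine Finset.sum_eq_zero fun i _ => ?_
    have := mem_maximalIdeal_of_sum_mem_sq ht (c := b) (by simpa using hg0) i
    rw [← hb, Ideal.Quotient.eq_zero_iff_mem.2 this, zero_smul]
  have hTS : ∀ p, T (S p) = p := by
    intro p
    have : T.comp S = AlgHom.id _ _ := by
      refine MvPolynomial.algHom_ext fun i => ?_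
      have hX := isHomogeneous_X (R ⧸ maximalIdeal R) i
      exact sub_eq_zero.1 (hlin (T (S (X i)) - X i) ((hT _ _ (hS _ _ hX)).sub hX)
        (by rw [map_sub, hTf, hSf, sub_self]))
    exact DFunLike.congr_fun this p
  rw [injective_iff_map_eq_zero]
  intro p hp
  have hSp : S p ∈ Ideal.span G := by
    rw [hGker, RingHom.mem_ker, hSf, hp]
  have hGT : Ideal.span G ≤ RingHom.ker T := by
    rw [Ideal.span_le]
    intro g hg
    refine hlin _ (hT _ _ (hG g hg)) ?_
    rw [hTf]
    have : g ∈ RingHom.ker (ofForms f hf) := hGker ▸ Ideal.subset_span hg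
    exact this
  rw [← hTS p]
  exact hGT hSp

theorem IsRegularLocalRing.of_algEquiv_associatedGraded {d : ℕ}
    (e : MvPolynomial (Fin d) (R ⧸ maximalIdeal R) ≃ₐ[R ⧸ maximalIdeal R]
      AssociatedGraded (maximalIdeal R)) : IsRegularLocalRing R := by
  have hrep : ∀ (n : ℕ) (a : AssociatedGraded (maximalIdeal R)), ∃ x hx,
      component (maximalIdeal R) n a = GradedPiece.mk (maximalIdeal R) n x hx := fun n a => by
    obtain ⟨x, hx⟩ := Submodule.Quotient.mk_surjective _ (component (maximalIdeal R) n a)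
    exact ⟨x.1, x.2, hx.symm⟩
  -- Only the degree-one part of `e (X i)` is lifted, since `e` is not assumed to be graded.
  choose t ht1 ht using fun i => hrep 1 (e (X i))
  have htm : ∀ i, t i ∈ maximalIdeal R := fun i => by simpa using ht1 i
  set N := Ideal.span (Set.range t) with hN
  -- By the Leibniz rule, the `t i` generate all degree-one parts of elements in the image of `e`.
  -- As `e` is surjective, they generate 𝔪 modulo 𝔪².
  have hgood : ∀ p, ∃ y ∈ N, ∃ hy,
      component (maximalIdeal R) 1 (e p) = GradedPiece.mk (maximalIdeal R) 1 y hy := by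
    intro p
    induction p using MvPolynomial.induction_on with
    | C a =>
      obtain ⟨r, rfl⟩ := Ideal.Quotient.mk_surjective a
      refine ⟨0, zero_mem _, zero_mem _, ?_⟩
      rw [← algebraMap_eq, AlgEquiv.commutes, algebraMap_mk, component_of_ne (by simp)]
      exact (GradedPiece.mk_eq_zero _ (zero_mem _)).symm
    | add p q hp hq =>
      obtain ⟨y, hyN, hy, ey⟩ := hp
      obtain ⟨z, hzN, hz, ez⟩ := hq
      refine ⟨y + z, add_mem hyN hzN, add_mem hy hz, ?_⟩
      rw [map_add, map_add, ey, ez]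
      rfl
    | mul_X p i hp =>
      obtain ⟨y, hyN, hy, ey⟩ := hp
      obtain ⟨r, hr, er⟩ := hrep 0 (e p)
      obtain ⟨r', hr', er'⟩ := hrep 0 (e (X i))
      refine ⟨r * t i + y * r', add_mem (Ideal.mul_mem_left _ _ (Ideal.subset_span ⟨i, rfl⟩))
        (Ideal.mul_mem_right _ _ hyN), ?_⟩
      rw [map_mul]
      exact ⟨_, component_one_mul_eq_mk er ey er' (ht i)⟩
  have hspan : Ideal.span (Set.range t) = maximalIdeal R := by
    refine le_antisymm (Ideal.span_le.2 (by rintro _ ⟨i, rfl⟩; exact htm i)) ?_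
    refine Submodule.le_of_le_smul_of_le_jacobson_bot
      (maximalIdeal R).fg_of_isNoetherianRing (maximalIdeal_le_jacobson _) fun x hx => ?_
    have hx1 : x ∈ maximalIdeal R ^ 1 := by simpa using hx
    obtain ⟨p, hp⟩ := e.surjective
      (AssociatedGraded.of (maximalIdeal R) 1 (GradedPiece.mk (maximalIdeal R) 1 x hx1))
    obtain ⟨y, hyN, hy, ey⟩ := hgood p
    rw [hp, component_of_same] at ey
    have hxy := (mk_eq_mk_iff hx1 hy).1 ey
    rw [← sub_add_cancel x y]
    refine add_mem (Ideal.mem_sup_right ?_) (Ideal.mem_sup_left hyN)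
    rwa [smul_eq_mul, ← pow_two]
  have hsurj := ofForms_surjective htm hspan
  have hinj : Function.Injective (ofForms t htm) := by
    -- Composing with the inverse of `e` gives a surjective endomorphism of a Noetherian polynomial
    -- ring.
    have h1 : Function.Injective (e.symm.toAlgHom.comp (ofForms t htm)).toRingHom :=
      RingHom.injective_of_surjective_of_isNoetherianRing _ (e.symm.surjective.comp hsurj)
    exact Function.Injective.of_comp (f := e.symm) h1
  refine IsRegularLocalRing.of_spanFinrank_maximalIdeal_le R
    (le_trans ?_ ((ofForms_injective_iff_le_ringKrullDim htm hspan).1 hinj))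
  have h1 : (maximalIdeal R).spanFinrank ≤ (Set.range t).ncard := by
    conv_lhs => rw [← hspan]
    exact Submodule.spanFinrank_span_le_ncard_of_finite (Set.finite_range t)
  have h2 : (Set.range t).ncard ≤ d := by
    rw [← Set.image_univ]
    exact (Set.ncard_image_le Set.finite_univ).trans (by simp [Set.ncard_univ])
  exact_mod_cast h1.trans h2

theorem isRegularLocalRing_tfae {ι : Type*} {f : ι → R} (hf : ∀ i, f i ∈ maximalIdeal R)
    (hfm : Ideal.span (Set.range f) = maximalIdeal R) :
    List.TFAE
      [IsRegularLocalRing R,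
        ∃ d : ℕ, Nonempty (MvPolynomial (Fin d) (R ⧸ maximalIdeal R) ≃ₐ[R ⧸ maximalIdeal R]
          AssociatedGraded (maximalIdeal R)),
        IsGeneratedByLinear (RingHom.ker (ofForms f hf))] := by
  obtain ⟨t, ht⟩ := exists_fin_span_range_eq_maximalIdeal R
  have htm : ∀ i, t i ∈ maximalIdeal R := fun i => by
    rw [← ht]; exact Ideal.subset_span ⟨i, rfl⟩
  have hinj : IsRegularLocalRing R → Function.Injective (ofForms t htm) := fun h =>
    (ofForms_injective_iff_le_ringKrullDim htm ht).2 h.spanFinrank_maximalIdeal.le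
  tfae_have 1 → 2 := fun h =>
    ⟨_, ⟨AlgEquiv.ofBijective _ ⟨hinj h, ofForms_surjective htm ht⟩⟩⟩
  tfae_have 2 → 1 := fun ⟨_, ⟨e⟩⟩ => IsRegularLocalRing.of_algEquiv_associatedGraded e
  tfae_have 1 → 3 := fun h => isGeneratedByLinear_ker_ofForms hf hfm htm ht (hinj h)
  tfae_have 3 → 1 := fun h => IsRegularLocalRing.of_isGeneratedByLinear hf hfm h
  tfae_finish

end QuasiRegular

/-! ### Homomorphisms out of `Q⁰ = k(U)[V]` -/

section Extension

variable {k : Type*} [Field k] {σ : Type*} {U : Set σ}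

@[simp]
theorem toQ0_C (a : k) :
    toQ0 k U (C a) =
      C (algebraMap (MvPolynomial ↥U k) (FractionRing (MvPolynomial ↥U k)) (C a)) := by
  simp [toQ0]

theorem toQ0_X_of_mem {x : σ} (hx : x ∈ U) : toQ0 k U (X x) =
    C (algebraMap (MvPolynomial ↥U k) (FractionRing (MvPolynomial ↥U k)) (X ⟨x, hx⟩)) := by
  simp [toQ0, hx]

theorem toQ0_X_of_notMem {x : σ} (hx : x ∉ U) : toQ0 k U (X x) = X ⟨x, hx⟩ := by
  simp [toQ0, hx]

theorem toQ0_rename (u : MvPolynomial ↥U k) : toQ0 k U (rename (↑) u) =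
    C (algebraMap (MvPolynomial ↥U k) (FractionRing (MvPolynomial ↥U k)) u) := by
  have : (toQ0 k U).comp (rename ((↑) : U → σ)).toRingHom =
      C.comp (algebraMap (MvPolynomial ↥U k) (FractionRing (MvPolynomial ↥U k))) := by
    refine MvPolynomial.ringHom_ext (fun a => ?_) fun i => ?_
    · simp
    · simp [toQ0_X_of_mem i.2]
  exact DFunLike.congr_fun this u

theorem isUnit_toQ0_rename {u : MvPolynomial ↥U k} (hu : u ≠ 0) :
    IsUnit (toQ0 k U (rename (↑) u)) := by
  rw [toQ0_rename]
  refine IsUnit.map C (IsUnit.mk0 _ ?_)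
  rwa [Ne, map_eq_zero_iff _ (IsFractionRing.injective _ _)]

/-- Every element of `Q⁰` is a fraction with numerator in `Q` and denominator in `k[U]`. -/
theorem exists_mul_eq_toQ0 (q : Q0 k U) : ∃ (u : MvPolynomial ↥U k) (p : MvPolynomial σ k),
    u ≠ 0 ∧ toQ0 k U (rename (↑) u) * q = toQ0 k U p := by
  induction q using MvPolynomial.induction_on with
  | C a =>
    obtain ⟨x, y, hy, rfl⟩ := IsFractionRing.div_surjective (A := MvPolynomial ↥U k) a
    have hy0 := nonZeroDivisors.ne_zero hy
    refine ⟨y, rename (↑) x, hy0, ?_⟩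
    rw [toQ0_rename, toQ0_rename, ← map_mul, mul_div_cancel₀]
    rwa [Ne, map_eq_zero_iff _ (IsFractionRing.injective _ _)]
  | add a b ha hb =>
    obtain ⟨u, p, hu, e⟩ := ha
    obtain ⟨w, q, hw, e'⟩ := hb
    refine ⟨u * w, rename ((↑) : U → σ) w * p + rename ((↑) : U → σ) u * q, mul_ne_zero hu hw, ?_⟩
    rw [map_mul, map_mul, map_add, map_mul, map_mul, ← e, ← e']
    ring
  | mul_X a i ha =>
    obtain ⟨u, p, hu, e⟩ := ha
    refine ⟨u, p * X (i : σ), hu, ?_⟩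
    rw [map_mul, ← e, toQ0_X_of_notMem i.2, mul_assoc]

theorem IsIndependentSet.rename_notMem {J : Ideal (MvPolynomial σ k)} (hU : IsIndependentSet J U)
    {u : MvPolynomial ↥U k} (hu : u ≠ 0) : rename ((↑) : U → σ) u ∉ J := fun h => by
  have := hU _ h ⟨u, rfl⟩
  rw [map_eq_zero_iff _ (rename_injective _ Subtype.val_injective)] at this
  exact hu this

variable {R : Type*} [CommRing R] (ι : MvPolynomial σ k →+* R)
  (hι : ∀ u : MvPolynomial ↥U k, u ≠ 0 → IsUnit (ι (rename (↑) u)))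

/-- The extension to `Q⁰ = k(U)[V]` of a ring homomorphism on `Q = k[X]` which maps the nonzero
elements of `k[U]` to units. -/
def liftQ0 : Q0 k U →+* R :=
  eval₂Hom (IsLocalization.lift (M := nonZeroDivisors (MvPolynomial ↥U k))
    (g := ι.comp (rename ((↑) : U → σ)).toRingHom)
    fun u => hι u (nonZeroDivisors.ne_zero u.2)) fun v => ι (X ↑v)

theorem liftQ0_toQ0 (p : MvPolynomial σ k) : liftQ0 ι hι (toQ0 k U p) = ι p := by
  have : (liftQ0 ι hι).comp (toQ0 k U) = ι := by
    refine MvPolynomial.ringHom_ext (fun a => ?_) fun x => ?_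
    · rw [RingHom.comp_apply, toQ0_C, liftQ0, coe_eval₂Hom, eval₂_C, IsLocalization.lift_eq]
      simp
    · by_cases hx : x ∈ U
      · rw [RingHom.comp_apply, toQ0_X_of_mem hx, liftQ0, coe_eval₂Hom, eval₂_C,
          IsLocalization.lift_eq]
        simp
      · rw [RingHom.comp_apply, toQ0_X_of_notMem hx, liftQ0, coe_eval₂Hom, eval₂_X]
  exact DFunLike.congr_fun this p

/-- Denominators from `k[U]` are units in `Q⁰`, so membership may be tested on a numerator in `Q`.
-/
theorem liftQ0_mem_iff {I : Ideal (MvPolynomial σ k)} {I' : Ideal R}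
    (h : ∀ p, ι p ∈ I' ↔ p ∈ I) (q : Q0 k U) : liftQ0 ι hι q ∈ I' ↔ q ∈ ideal0 I U := by
  constructor
  · intro hq
    obtain ⟨u, p, hu, e⟩ := exists_mul_eq_toQ0 q
    rw [← Ideal.unit_mul_mem_iff_mem _ (isUnit_toQ0_rename hu), e]
    refine Ideal.mem_map_of_mem _ ((h p).1 ?_)
    rw [← liftQ0_toQ0 ι hι, ← e, map_mul]
    exact Ideal.mul_mem_left _ _ hq
  · intro hq
    have : ideal0 I U ≤ I'.comap (liftQ0 ι hι) := by
      rw [Ideal.map_le_iff_le_comap]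
      intro p hp
      rw [Ideal.mem_comap, Ideal.mem_comap, liftQ0_toQ0]
      exact (h p).2 hp
    exact this hq

theorem liftQ0_eq_zero_iff {I : Ideal (MvPolynomial σ k)} (h : ∀ p, ι p = 0 ↔ p ∈ I) (q : Q0 k U) :
    liftQ0 ι hι q = 0 ↔ q ∈ ideal0 I U :=
  liftQ0_mem_iff ι hι (I' := ⊥) (fun p => by rw [Ideal.mem_bot, h]) q

/-- By maximality of `U`, some nonzero element of `J` involves only `U` and `v`. Read as a
polynomial in `v` over `k(U)`, it is an algebraic equation for the image of `v`. -/
theorem isAlgebraic_apply_X {J : Ideal (MvPolynomial σ k)} (hU : IsMaximalIndependentSet J U)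
    {D : Type*} [CommRing D] [Algebra (FractionRing (MvPolynomial ↥U k)) D]
    (g : Q0 k U →ₐ[FractionRing (MvPolynomial ↥U k)] D) (hg : ∀ p ∈ J, g (toQ0 k U p) = 0)
    (v : ↥(Uᶜ)) : IsAlgebraic (FractionRing (MvPolynomial ↥U k)) (g (X v)) := by
  classical
  have hv : ¬ IsIndependentSet J (insert (v : σ) U) := fun h =>
    v.2 (hU.le_of_ge h (Set.subset_insert _ _) (Set.mem_insert _ _))
  unfold IsIndependentSet at hv
  push Not at hv
  obtain ⟨_, hpJ, ⟨p, rfl⟩, hp0⟩ := hv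
  let e : ↥(insert (v : σ) U) ≃ Option ↥U := Set.subtypeInsertEquivOption v.2
  let φ := algebraMap (MvPolynomial ↥U k) (FractionRing (MvPolynomial ↥U k))
  have hC : ∀ a, g (C a) = algebraMap _ D a := g.commutes
  have key : ∀ p : MvPolynomial ↥(insert (v : σ) U) k,
      Polynomial.aeval (g (X v)) ((optionEquivLeft k ↥U (rename e p)).map φ) =
        g (toQ0 k U (rename (↑) p)) := by
    intro p
    induction p using MvPolynomial.induction_on with
    | C a =>
      rw [rename_C, rename_C, optionEquivLeft_C, Polynomial.map_C, Polynomial.aeval_C, toQ0_C, hC]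
    | add a b ha hb => simp only [map_add, Polynomial.map_add, ha, hb]
    | mul_X a i ha =>
      rw [map_mul, map_mul, Polynomial.map_mul, map_mul, ha, map_mul, map_mul, map_mul]
      congr 1
      rw [rename_X, rename_X]
      obtain ⟨x, hx⟩ := i
      by_cases hxv : x = v
      · have he : e ⟨x, hx⟩ = none := by simp [e, Set.subtypeInsertEquivOption, hxv]
        subst hxv
        rw [he, optionEquivLeft_X_none, Polynomial.map_X, Polynomial.aeval_X,
          toQ0_X_of_notMem v.2]
      · have hxU : x ∈ U := hx.resolve_left hxv
        have he : e ⟨x, hx⟩ = some ⟨x, hxU⟩ := by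
          simp [e, Set.subtypeInsertEquivOption, hxv]
        rw [he, optionEquivLeft_X_some, Polynomial.map_C, Polynomial.aeval_C, toQ0_X_of_mem hxU,
          hC]
  refine ⟨(optionEquivLeft k ↥U (rename e p)).map φ, fun h => hp0 ?_, ?_⟩
  · rw [Polynomial.map_eq_zero_iff (IsFractionRing.injective _ _),
      map_eq_zero_iff _ (AlgEquiv.injective _),
      map_eq_zero_iff _ (rename_injective _ e.injective)] at h
    rw [h, map_zero]
  · rw [key, hg _ hpJ]

/-- The image of `g` is a domain algebraic over the field `k(U)`, hence itself a field. This is the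
maximality of `J⁰` in the form needed to invert denominators. -/
theorem exists_apply_mul_apply_eq_one {J : Ideal (MvPolynomial σ k)}
    (hU : IsMaximalIndependentSet J U) {L : Type*} [Field L] (g : Q0 k U →+* L)
    (hg : ∀ p ∈ J, g (toQ0 k U p) = 0) {q : Q0 k U} (hq : g q ≠ 0) : ∃ q', g q * g q' = 1 := by
  let := (g.comp C).toAlgebra
  let g' : Q0 k U →ₐ[FractionRing (MvPolynomial ↥U k)] L := { g with commutes' := fun _ => rfl }
  have hint : IsIntegral (FractionRing (MvPolynomial ↥U k)) (g' q) := by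
    clear hq
    induction q using MvPolynomial.induction_on with
    | C a =>
      rw [← algebraMap_eq, AlgHom.commutes]
      exact isIntegral_algebraMap
    | add a b ha hb => rw [map_add]; exact ha.add hb
    | mul_X a v ha => rw [map_mul]; exact ha.mul (isAlgebraic_apply_X hU g' hg v).isIntegral
  obtain ⟨q', hq'⟩ := Subalgebra.inv_mem_of_algebraic (A := g'.range) (x := ⟨g' q, q, rfl⟩)
    hint.isAlgebraic
  refine ⟨q', ?_⟩
  have e : g q' = (g q)⁻¹ := hq'
  rw [e, mul_inv_cancel₀ hq]

end Extension

/-! ### Linear generation, initial forms and evaluation -/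

theorem IsGeneratedByLinear.map {τ S S' : Type*} [CommSemiring S] [CommSemiring S']
    {I : Ideal (MvPolynomial τ S)} (h : IsGeneratedByLinear I) (g : S →+* S') :
    IsGeneratedByLinear (I.map (MvPolynomial.map g)) := by
  obtain ⟨G, hG, rfl⟩ := h
  refine ⟨MvPolynomial.map g '' G, ?_, (Ideal.map_span _ _).symm⟩
  rintro _ ⟨p, hp, rfl⟩
  exact (hG p hp).map g

theorem isGeneratedByLinear_map_iff {τ S S' : Type*} [CommSemiring S] [CommSemiring S']
    {I : Ideal (MvPolynomial τ S)} (e : S ≃+* S') :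
    IsGeneratedByLinear (I.map (MvPolynomial.map (e : S →+* S'))) ↔ IsGeneratedByLinear I := by
  refine ⟨fun h => ?_, fun h => h.map _⟩
  have := h.map (e.symm : S' →+* S)
  have e' : (MvPolynomial.map (σ := τ) (e.symm : S' →+* S)).comp
      (MvPolynomial.map (e : S →+* S')) = RingHom.id _ := by
    refine RingHom.ext fun p => ?_
    rw [RingHom.comp_apply, MvPolynomial.map_map, RingEquiv.symm_comp, MvPolynomial.map_id]
    rfl
  rwa [Ideal.map_map, e', Ideal.map_id] at this

theorem homogeneousComponent_eq_zero_of_lt_lowestDegree {s : ℕ} {S : Type*} [CommRing S]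
    {g : MvPolynomial (Fin s) S} {j : ℕ} (hj : j < lowestDegree g) :
    homogeneousComponent j g = 0 := by
  refine homogeneousComponent_eq_zero' _ _ fun α hα h => ?_
  have hmem : j ∈ Finsupp.degree '' (g.support : Set (Fin s →₀ ℕ)) := ⟨α, hα, h⟩
  exact absurd (Nat.sInf_le hmem) (not_le.2 hj)

theorem lowestDegree_eq {s : ℕ} {S : Type*} [CommRing S] {p q : MvPolynomial (Fin s) S} {n : ℕ}
    (hp : p.IsHomogeneous n) (hp0 : p ≠ 0) (hq : q.IsHomogeneous (n + 1)) :
    lowestDegree (p + q) = n := by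
  refine IsLeast.csInf_eq ⟨?_, ?_⟩
  · obtain ⟨α, hα⟩ := ne_zero_iff.1 hp0
    have hαn : α.degree = n := by
      by_contra h
      exact hα (hp.coeff_eq_zero h)
    refine ⟨α, ?_, hαn⟩
    rw [Finset.mem_coe, mem_support_iff, coeff_add, hq.coeff_eq_zero (by omega), add_zero]
    exact hα
  · rintro _ ⟨α, hα, rfl⟩
    by_contra! h
    rw [Finset.mem_coe, mem_support_iff, coeff_add, hq.coeff_eq_zero (by omega),
      hp.coeff_eq_zero (by omega), add_zero] at hα
    exact hα rfl

theorem initialForm_add {s : ℕ} {S : Type*} [CommRing S] {p q : MvPolynomial (Fin s) S} {n : ℕ}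
    (hp : p.IsHomogeneous n) (hp0 : p ≠ 0) (hq : q.IsHomogeneous (n + 1)) :
    initialForm (p + q) = p := by
  rw [initialForm, lowestDegree_eq hp hp0 hq, map_add, homogeneousComponent_eq_self hp,
    homogeneousComponent_of_mem (m := n) hq, if_neg (by omega), add_zero]

/-- A form of degree above `n` takes values in `I ^ (n + 1)`, so only the lowest form matters modulo
that power. -/
theorem eval_sub_eval_homogeneousComponent_mem {ι R : Type*} [CommRing R] {I : Ideal R}
    {f : ι → R} (hf : ∀ i, f i ∈ I) {n : ℕ} {p : MvPolynomial ι R}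
    (hp : ∀ j < n, homogeneousComponent j p = 0) :
    eval f p - eval f (homogeneousComponent n p) ∈ I ^ (n + 1) := by
  have hmem : ∀ j, j ≠ n → eval f (homogeneousComponent j p) ∈ I ^ (n + 1) := fun j hj => by
    rcases lt_or_gt_of_ne hj with h | h
    · rw [hp j h, map_zero]
      exact zero_mem _
    · exact Ideal.pow_le_pow_right h (eval_mem_pow (homogeneousComponent_isHomogeneous j p) hf)
  by_cases hn : n ∈ Finset.range (p.totalDegree + 1)
  · have e : eval f p = eval f (homogeneousComponent n p) +
        ∑ j ∈ (Finset.range (p.totalDegree + 1)).erase n, eval f (homogeneousComponent j p) := by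
      rw [Finset.add_sum_erase _ (fun j => eval f (homogeneousComponent j p)) hn, ← map_sum,
        sum_homogeneousComponent]
    rw [e, add_sub_cancel_left]
    exact sum_mem fun j hj => hmem j (Finset.ne_of_mem_erase hj)
  · rw [homogeneousComponent_eq_zero n p (by simpa using hn), map_zero, sub_zero]
    have e : eval f p =
        ∑ j ∈ Finset.range (p.totalDegree + 1), eval f (homogeneousComponent j p) := by
      rw [← map_sum, sum_homogeneousComponent]
    rw [e]
    exact sum_mem fun j hj => hmem j (by rintro rfl; exact hn hj)

/-- Denominators of the coefficients of a form can be cleared simultaneously. -/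
theorem exists_map_eq_C_mul {S R ι : Type*} [CommRing S] [CommRing R] (θ : S →+* R)
    (M : Submonoid S) (h : ∀ r, ∃ a ∈ M, ∃ b, θ a * r = θ b) {n : ℕ} {p : MvPolynomial ι R}
    (hp : p.IsHomogeneous n) : ∃ a ∈ M, ∃ q : MvPolynomial ι S, q.IsHomogeneous n ∧
      map θ q = C (θ a) * p := by
  rw [p.as_sum]
  refine Finset.sum_induction _ (fun p => ∃ a ∈ M, ∃ q : MvPolynomial ι S, q.IsHomogeneous n ∧
      map θ q = C (θ a) * p) ?_ ?_ ?_
  · rintro p p' ⟨a, ha, q, hq, e⟩ ⟨a', ha', q', hq', e'⟩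
    refine ⟨a * a', M.mul_mem ha ha', C a' * q + C a * q', (hq.C_mul _).add (hq'.C_mul _), ?_⟩
    simp only [map_add, map_mul, map_C, e, e']
    ring
  · exact ⟨1, M.one_mem, 0, isHomogeneous_zero _ _ _, by simp⟩
  · intro α hα
    obtain ⟨a, ha, b, e⟩ := h (coeff α p)
    refine ⟨a, ha, monomial α b,
      isHomogeneous_monomial _ (hp.degree_eq_sum_deg_support hα).symm, ?_⟩
    rw [map_monomial, C_mul_monomial, e]

theorem sub_C_eval_mem_span {S ι : Type*} [CommRing S] (x : ι → S) (g : MvPolynomial ι S) :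
    g - C (eval x g) ∈ Ideal.span (Set.range fun i => C (x i) - X i) := by
  induction g using MvPolynomial.induction_on with
  | C a => simp
  | add a b ha hb =>
    rw [map_add, map_add, add_sub_add_comm]
    exact add_mem ha hb
  | mul_X a i ha =>
    have e : a * X i - C (eval x (a * X i)) =
        (a - C (eval x a)) * X i - C (eval x a) * (C (x i) - X i) := by
      rw [map_mul, eval_X, map_mul]
      ring
    rw [e]
    exact sub_mem (Ideal.mul_mem_right _ _ ha) (Ideal.mul_mem_left _ _
      (Ideal.subset_span ⟨i, rfl⟩))

/-! ### Initial forms and the kernel of the presentation -/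

section Bridge

variable {k : Type*} [Field k] {σ : Type*} {U : Set σ} {H J : Ideal (MvPolynomial σ k)}
  {R : Type*} [CommRing R] {s : ℕ} {f : Fin s → MvPolynomial σ k}
  (ι : MvPolynomial σ k →+* R)
  (hι : ∀ u : MvPolynomial ↥U k, u ≠ 0 → IsUnit (ι (rename (↑) u)))

/-- Modulo the elements `f_i - Y_i` every polynomial is congruent to its value at `f` in `Q⁰`, and
that value vanishes in `R` exactly when it lies in `H⁰`. -/
theorem mem_idealFrakI_iff (hH : ∀ p, ι p = 0 ↔ p ∈ H) (g : MvPolynomial (Fin s) (Q0 k U)) :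
    g ∈ idealFrakI H U f ↔ eval (fun i => ι (f i)) (map (liftQ0 ι hι) g) = 0 := by
  constructor
  · intro hg
    have : idealFrakI H U f ≤
        RingHom.ker ((eval fun i => ι (f i)).comp (map (liftQ0 ι hι))) := by
      refine sup_le ?_ ?_
      · rw [Ideal.span_le]
        rintro _ ⟨i, rfl⟩
        simp [RingHom.mem_ker, liftQ0_toQ0]
      · rw [Ideal.map_le_iff_le_comap]
        intro q hq
        simpa [RingHom.mem_ker] using (liftQ0_eq_zero_iff ι hι hH q).2 hq
    exact this hg
  · intro hg
    have e : liftQ0 ι hι (eval (fun i => toQ0 k U (f i)) g) =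
        eval (fun i => ι (f i)) (map (liftQ0 ι hι) g) := by
      rw [eval_map, eval₂_comp]
      congr 1
      funext i
      exact liftQ0_toQ0 ι hι (f i)
    rw [← e, liftQ0_eq_zero_iff ι hι hH] at hg
    rw [← sub_add_cancel g (C (eval (fun i => toQ0 k U (f i)) g))]
    exact add_mem (Ideal.mem_sup_left (sub_C_eval_mem_span _ g)) (Ideal.mem_sup_right (Ideal.mem_map_of_mem _ hg))

variable [IsLocalRing R]

/-- The canonical isomorphism from `Q⁰ / J⁰` to the residue field of the localization. -/
theorem exists_ringEquiv_residue (hJ : ∀ p, ι p ∈ maximalIdeal R ↔ p ∈ J)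
    (hfrac : ∀ r, ∃ a b, b ∉ J ∧ ι b * r = ι a) (hU : IsMaximalIndependentSet J U) :
    ∃ e : Q0 k U ⧸ ideal0 J U ≃+* R ⧸ maximalIdeal R, ∀ q,
      e (Ideal.Quotient.mk _ q) = Ideal.Quotient.mk _ (liftQ0 ι hι q) := by
  have hmem := liftQ0_mem_iff ι hι hJ
  let ψ : Q0 k U ⧸ ideal0 J U →+* R ⧸ maximalIdeal R :=
    Ideal.quotientMap _ (liftQ0 ι hι) fun q hq => (hmem q).2 hq
  refine ⟨RingEquiv.ofBijective ψ ⟨?_, ?_⟩, fun q => rfl⟩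
  · exact Ideal.quotientMap_injective' fun q hq => (hmem q).1 hq
  · intro z
    obtain ⟨r, rfl⟩ := Ideal.Quotient.mk_surjective z
    obtain ⟨a, b, hb, e⟩ := hfrac r
    have hb' : ((residue R).comp (liftQ0 ι hι)) (toQ0 k U b) ≠ 0 := by
      rw [RingHom.comp_apply, liftQ0_toQ0, Ne, residue_eq_zero_iff, hJ]
      exact hb
    -- The denominator `b` already has an inverse in the image of `Q⁰` in the residue field, which
    -- gives surjectivity.
    obtain ⟨q, hq⟩ := exists_apply_mul_apply_eq_one hU ((residue R).comp (liftQ0 ι hι))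
      (fun p hp => by rw [RingHom.comp_apply, liftQ0_toQ0, residue_eq_zero_iff, hJ]; exact hp) hb'
    refine ⟨Ideal.Quotient.mk _ (q * toQ0 k U a), ?_⟩
    change residue R (liftQ0 ι hι (q * toQ0 k U a)) = residue R r
    rw [RingHom.comp_apply, RingHom.comp_apply, liftQ0_toQ0] at hq
    rw [map_mul, liftQ0_toQ0, ← e, map_mul, map_mul, ← mul_assoc, mul_comm (residue R _), hq,
      one_mul]

/-- The canonical isomorphism `Q⁰ / J⁰ ≅ R / 𝔪` maps the ideal of initial forms to the kernel of
the presentation of the associated graded ring. -/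
theorem map_idealIn_eq_ker (hJ : ∀ p, ι p ∈ maximalIdeal R ↔ p ∈ J) (hH : ∀ p, ι p = 0 ↔ p ∈ H)
    (hfrac : ∀ r, ∃ a b, b ∉ J ∧ ι b * r = ι a) (hf : ∀ i, ι (f i) ∈ maximalIdeal R)
    (hfm : Ideal.span (Set.range fun i => ι (f i)) = maximalIdeal R)
    (e : Q0 k U ⧸ ideal0 J U ≃+* R ⧸ maximalIdeal R)
    (he : ∀ q, e (Ideal.Quotient.mk _ q) = Ideal.Quotient.mk _ (liftQ0 ι hι q)) :
    (idealIn H J U f).map (map (e : Q0 k U ⧸ ideal0 J U →+* R ⧸ maximalIdeal R)) =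
      RingHom.ker (ofForms (fun i => ι (f i)) hf) := by
  have hcomp : (e : Q0 k U ⧸ ideal0 J U →+* R ⧸ maximalIdeal R).comp
      (Ideal.Quotient.mk (ideal0 J U)) =
      (Ideal.Quotient.mk _).comp (liftQ0 ι hι) := RingHom.ext he
  have hmap : ∀ g : MvPolynomial (Fin s) (Q0 k U),
      map (e : Q0 k U ⧸ ideal0 J U →+* R ⧸ maximalIdeal R)
        (map (Ideal.Quotient.mk (ideal0 J U)) g : MvPolynomial (Fin s) (Q0 k U ⧸ ideal0 J U)) =
        map (Ideal.Quotient.mk (maximalIdeal R)) (map (liftQ0 ι hι) g) := fun g => by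
    rw [map_map, map_map, hcomp]
  have hmem := liftQ0_mem_iff ι hι hJ
  apply le_antisymm
  · rw [Ideal.map_le_iff_le_comap, idealIn, Ideal.span_le]
    rintro _ ⟨g, hg, rfl⟩
    rw [SetLike.mem_coe, Ideal.mem_comap, RingHom.mem_ker, initialFormK, hmap, initialForm]
    rw [ofForms_map_eq_zero_iff hf ((homogeneousComponent_isHomogeneous _ _).map _),
      MvPolynomial.map_homogeneousComponent]
    have h0 := (mem_idealFrakI_iff ι hι hH g).1 hg
    have h1 := eval_sub_eval_homogeneousComponent_mem hf (n := lowestDegree g)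
      (p := map (liftQ0 ι hι) g) fun j hj => by
        rw [← MvPolynomial.map_homogeneousComponent,
          homogeneousComponent_eq_zero_of_lt_lowestDegree hj, map_zero]
    rw [h0, zero_sub] at h1
    exact neg_mem_iff.1 h1
  · intro F hF
    rw [RingHom.mem_ker, ofForms_eq_zero_iff] at hF
    rw [← sum_homogeneousComponent F]
    refine sum_mem fun n _ => ?_
    have hFn := hF n
    have hhom := homogeneousComponent_isHomogeneous n F
    set G := homogeneousComponent n F
    by_cases hG0 : G = 0
    · rw [hG0]; exact zero_mem _
    have hsurj : Function.Surjective ((Ideal.Quotient.mk (maximalIdeal R)).comp (liftQ0 ι hι)) := by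
      rw [← hcomp]
      exact e.surjective.comp Ideal.Quotient.mk_surjective
    obtain ⟨g, hg, hgG⟩ := hhom.exists_map_eq hsurj
    rw [← map_map] at hgG
    rw [← hgG, ofForms_map_eq_zero_iff hf (hg.map _)] at hFn
    conv at hFn => rw [← hfm, Ideal.mem_span_pow_iff_exists_isHomogeneous]
    obtain ⟨p, hp, hpe⟩ := hFn
    have : (ideal0 J U).IsPrime := by
      have hcm : ideal0 J U = (maximalIdeal R).comap (liftQ0 ι hι) := by
        ext q; exact (hmem q).symm
      rw [hcm]
      infer_instance
    -- The form `p` has coefficients in `R`, not in `Q⁰`; multiplying by some `a ∉ J⁰`, a unit in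
    -- `R`, brings them into the image of `Q⁰`.
    obtain ⟨a, ha, q, hq, hqp⟩ := exists_map_eq_C_mul (liftQ0 ι hι) (ideal0 J U).primeCompl
      (fun r => by
        obtain ⟨a, b, hb, e⟩ := hfrac r
        refine ⟨toQ0 k U b, fun h => hb ?_, toQ0 k U a, by rw [liftQ0_toQ0, liftQ0_toQ0, e]⟩
        rw [← hJ, ← liftQ0_toQ0 ι hι, hmem]
        exact h) hp
    have hga : (C a * g).IsHomogeneous n := hg.C_mul a
    have hmga : map (e : Q0 k U ⧸ ideal0 J U →+* R ⧸ maximalIdeal R)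
        (map (Ideal.Quotient.mk (ideal0 J U)) (C a * g) :
          MvPolynomial (Fin s) (Q0 k U ⧸ ideal0 J U)) =
          C (Ideal.Quotient.mk (maximalIdeal R) (liftQ0 ι hι a)) * G := by
      rw [hmap, map_mul, map_mul, hgG, map_C, map_C]
    have hau : IsUnit (liftQ0 ι hι a) := by
      by_contra h
      exact ha ((hmem a).1 ((mem_maximalIdeal _).2 h))
    have hunit : IsUnit (C (Ideal.Quotient.mk (maximalIdeal R) (liftQ0 ι hι a)) :
        MvPolynomial (Fin s) (R ⧸ maximalIdeal R)) := (hau.map _).map C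
    have hga0 : C a * g ≠ 0 := by
      intro h
      rw [h, map_zero, map_zero] at hmga
      exact hG0 ((hunit.mul_right_eq_zero).1 hmga.symm)
    -- This element of `𝔍` has initial form `a g`, as `q` has degree `n + 1`, and `a` reduces to a
    -- unit of `K`; so `G` is recovered.
    have hI : C a * g + -q ∈ idealFrakI H U f := by
      rw [mem_idealFrakI_iff ι hι hH, map_add, map_neg, hqp, map_mul, map_C, map_add, map_neg,
        map_mul, map_mul, eval_C, hpe, add_neg_cancel]
    have hin : initialFormK J U (C a * g + -q) =
        map (Ideal.Quotient.mk (ideal0 J U)) (C a * g) := by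
      rw [initialFormK, initialForm_add hga hga0 hq.neg]
    rw [← Ideal.unit_mul_mem_iff_mem _ hunit, ← hmga, ← hin]
    exact Ideal.mem_map_of_mem _ (Ideal.subset_span ⟨_, hI, rfl⟩)

end Bridge

end

/-! ### Application to `A_L` -/

theorem proposition3p2 {k : Type*} [Field k] {σ : Type*} [Finite σ]
    (H J : Ideal (MvPolynomial σ k)) [H.IsPrime] [J.IsPrime] (hHJ : H ≤ J)
    (U : Set σ) (hU : IsMaximalIndependentSet J U)
    {s : ℕ} (f : Fin s → MvPolynomial σ k) (hf : Ideal.span (Set.range f) = J) :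
    List.TFAE
      [IsRegularLocalRing (LocalizationAL hHJ),
        ∃ d : ℕ, Nonempty (MvPolynomial (Fin d) (LocalizationAL hHJ ⧸ idealAL hHJ)
          ≃ₐ[LocalizationAL hHJ ⧸ idealAL hHJ] AssociatedGraded (idealAL hHJ)),
        IsGeneratedByLinear (idealIn H J U f)] := by
  have hL := idealL_isPrime hHJ
  let ι : MvPolynomial σ k →+* LocalizationAL hHJ :=
    (algebraMap (MvPolynomial σ k ⧸ H) (LocalizationAL hHJ)).comp (Ideal.Quotient.mk H)
  have hnoeth : IsNoetherianRing (LocalizationAL hHJ) :=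
    IsLocalization.isNoetherianRing (idealL H J).primeCompl _ inferInstance
  have hJL : ∀ p, Ideal.Quotient.mk H p ∈ idealL H J ↔ p ∈ J := fun p => by
    rw [Ideal.mem_map_iff_of_surjective _ Ideal.Quotient.mk_surjective]
    refine ⟨?_, fun h => ⟨p, h, rfl⟩⟩
    rintro ⟨q, hq, e⟩
    have := sub_mem hq (hHJ (Ideal.Quotient.eq.1 e))
    rwa [sub_sub_cancel] at this
  have hιJ : ∀ p, ι p ∈ IsLocalRing.maximalIdeal (LocalizationAL hHJ) ↔ p ∈ J := fun p => by
    rw [← hJL, ← IsLocalization.AtPrime.to_map_mem_maximal_iff (LocalizationAL hHJ) (idealL H J)]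
    rfl
  have hιH : ∀ p, ι p = 0 ↔ p ∈ H := fun p => by
    rw [← Ideal.Quotient.eq_zero_iff_mem]
    exact map_eq_zero_iff _ (IsLocalization.injective (LocalizationAL hHJ)
      (idealL H J).primeCompl_le_nonZeroDivisors)
  have hfrac : ∀ r, ∃ a b, b ∉ J ∧ ι b * r = ι a := fun r => by
    obtain ⟨⟨x, y⟩, e⟩ := IsLocalization.surj (idealL H J).primeCompl r
    obtain ⟨a, rfl⟩ := Ideal.Quotient.mk_surjective x
    obtain ⟨b, hb⟩ := Ideal.Quotient.mk_surjective y.1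
    refine ⟨a, b, fun h => y.2 (by rw [← hb]; exact (hJL b).2 h), ?_⟩
    rw [mul_comm]
    simpa [ι, hb] using e
  -- Independence of `U` keeps nonzero elements of `k[U]` outside `J`, so they become units in `A_L`
  -- and `Q⁰` maps to `A_L`.
  have hι : ∀ u : MvPolynomial ↥U k, u ≠ 0 →
      IsUnit (ι (MvPolynomial.rename (↑) u)) := fun u hu => by
    by_contra h
    exact hU.prop.rename_notMem hu ((hιJ _).1 ((IsLocalRing.mem_maximalIdeal _).2 h))
  have hfι : ∀ i, ι (f i) ∈ IsLocalRing.maximalIdeal (LocalizationAL hHJ) := fun i =>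
    (hιJ _).2 (hf ▸ Ideal.subset_span ⟨i, rfl⟩)
  have hfm : Ideal.span (Set.range fun i => ι (f i)) =
      IsLocalRing.maximalIdeal (LocalizationAL hHJ) := by
    refine le_antisymm (Ideal.span_le.2 (by rintro _ ⟨i, rfl⟩; exact hfι i)) fun r hr => ?_
    obtain ⟨a, b, hb, e⟩ := hfrac r
    have hbu : IsUnit (ι b) := by
      by_contra h
      exact hb ((hιJ _).1 ((IsLocalRing.mem_maximalIdeal _).2 h))
    have ha : a ∈ J := by
      rw [← hιJ, ← e]
      exact Ideal.mul_mem_left _ _ hr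
    rw [← Ideal.unit_mul_mem_iff_mem _ hbu, e]
    have hle : J ≤ (Ideal.span (Set.range fun i => ι (f i))).comap ι :=
      hf.ge.trans (Ideal.span_le.2 (by rintro _ ⟨i, rfl⟩; exact Ideal.subset_span ⟨i, rfl⟩))
    exact hle ha
  obtain ⟨e, he⟩ := exists_ringEquiv_residue ι hι hιJ hfrac hU
  have hker := map_idealIn_eq_ker ι hι hιJ hιH hfrac hfι hfm e he
  rw [← isGeneratedByLinear_map_iff e, hker]
  exact isRegularLocalRing_tfae hfι hfm
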